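/- Fix integers $D\ge 1$ and $d$. For $L\ge 1$ let $\Lambda=\mathbb Z_L^D$ be the periodic cubic lattice with $N=L^D$ sites, each carrying $\mathbb C^d$. Let $\psi\in\mathbb C^d$ be a unit vector and $|\Psi\rangle=|\psi\rangle^{\otimes N}$. A Hamiltonian $H=\sum_{x\in\Lambda}h_x$ with Hermitian terms is called admissible with range $r$ and strength $J$ if every $h_x$ is supported on the sites whose coordinates differ from those of $x$ by at most $r$ (modulo $L$), $\|h_x\|\le J$ for all $x$, and $H$ commutes with all lattice translations. Put $U_t=e^{-iHt}$, $F(t)=|\langle\Psi|U_t|\Psi\rangle|$, let $\rho_x(t)=\operatorname{Tr}_{\{x\}^c}[U_t|\Psi\rangle\langle\Psi|U_t^\dagger]$ be the reduced density matrix of a site $x$, and set $$k(t)=-\log\langle\Psi|\rho_x(t)\otimes\mathbf 1|\Psi\rangle\in[0,\infty],\qquad -\log 0=\infty$$ (by translation invariance this does not depend on $x$). We write $k_L$, $F_L$ for the quantities at side length $L$, and $e^{-\infty}=0$. (1) For each $L\geq 1$ let $H_L$ be admissible on $\mathbb Z_L^D$, with $r$ and $J$ independent of $L$. Then for every $\delta>0$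 there is a time $0<\tau<\delta$ such that $k_L(\tau)>0$ for all $L$ for which $|\Psi\rangle$ is not an eigenstate of $H_L$. (2) For all $r$, $J$, $\tau>0$ and $\kappa>0$ there are constants $C$ and $L_0$ such that for all $L\ge L_0$, all unit vectors $\psi$ and all Hamiltonians on $\mathbb Z_L^D$ that are admissible with range $r$ and strength $J$ and satisfy $k_L(\tau)\ge\kappa$, $$F_L(\tau)^2\le C\exp\left(-\tfrac14\left[L^D k_L(\tau)\right]^{1/(1+D)}\right).$$ (3) Let $H_L$ be generated on every $\mathbb Z_L^D$ by one fixed interaction: $g$ is a Hermitian operator acting on a finite set $S$ of sites of $\mathbb Z^D$, and $h_x$ acts as $g$ on $x+S$ modulo $L$. Then for every unit vector $\psi$ and every $\tau>0$ there are $C$ and $L_0$ such that the bound in (2) holds for all $L\ge L_0$ with $k_L(\tau)>0$, without any lower bound on $k_L(\tau)$ that is uniform in $L$. -/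

import Mathlib

open scoped ENNReal NNReal

noncomputable section

namespace SpinLattice

/-- The sites of the `D`-dimensional cubic lattice `ℤ_L^D` with periodic boundary conditions. -/
abbrev Site (D L : ℕ) : Type := Fin D → ZMod L

/-- The labels of the standard product basis of `(ℂ^d)^{⊗ N}`, `N = L^D`. -/
abbrev Config (D d L : ℕ) : Type := Site D L → Fin d

/-- Vectors of `(ℂ^d)^{⊗ N}`, through their coefficients in the product basis. -/
abbrev StateVec (D d L : ℕ) : Type := Config D d L → ℂ

/-- Operators on `(ℂ^d)^{⊗ N}`, through their matrices in the product basis. -/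
abbrev Op (D d L : ℕ) : Type := Matrix (Config D d L) (Config D d L) ℂ

open Classical in
/-- For an injective map `ι` from an index set `S` to the sites, the operator that acts as `B` on the
sites `ι s`, `s ∈ S`, and as the identity on all other sites, that is, `B ⊗ 1`. -/
def embed {D d L : ℕ} {S : Type} (ι : S → Site D L) (B : Matrix (S → Fin d) (S → Fin d) ℂ) :
    Op D d L :=
  Matrix.of fun σ σ' =>
    if ∀ y, y ∉ Set.range ι → σ y = σ' y then B (fun s => σ (ι s)) (fun s => σ' (ι s)) else 0

/-- `A` is supported on the set `S` of sites: `A = B ⊗ 1` with `B` acting on the sites in `S`. -/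
def SupportedOn {D d L : ℕ} (S : Set (Site D L)) (A : Op D d L) : Prop :=
  ∃ B : Matrix (S → Fin d) (S → Fin d) ℂ, A = embed (fun s : S => (s : Site D L)) B

/-- The sites whose coordinates all differ from those of `x` by at most `r` (modulo `L`). -/
def ball {D L : ℕ} (x : Site D L) (r : ℕ) : Set (Site D L) :=
  {y | ∃ z : Fin D → ℤ, (∀ i, |z i| ≤ (r : ℤ)) ∧ ∀ i, y i = x i + (z i : ZMod L)}

/-- The Hamiltonian `H = ∑ x, h x`. -/
def hamiltonian {D d L : ℕ} [NeZero L] (h : Site D L → Op D d L) : Op D d L := ∑ x, h x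

/-- The operator `A` commutes with all lattice translations. -/
def TranslationInvariant {D d L : ℕ} (A : Op D d L) : Prop :=
  ∀ (a : Site D L) (σ σ' : Config D d L),
    A (fun x => σ (x + a)) (fun x => σ' (x + a)) = A σ σ'

open scoped Matrix.Norms.L2Operator in
/-- The local terms `h x` define a translation-invariant Hamiltonian which is strictly local, with
range `r`, and whose terms are bounded by `J` in operator norm. -/
structure IsLocalHamiltonian {D d L : ℕ} [NeZero L] (r : ℕ) (J : ℝ)
    (h : Site D L → Op D d L) : Prop where
  hermitian : ∀ x, (h x).IsHermitian
  strictly_local : ∀ x, SupportedOn (ball x r) (h x)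
  bounded : ∀ x, ‖h x‖ ≤ J
  invariant : TranslationInvariant (hamiltonian h)

/-- The local terms on `ℤ_L^D` given by one interaction `g`, which acts on the finite set `S` of
sites of `ℤ^D`: the term at `x` acts as `g` on the sites `x + s`, `s ∈ S`. (The sites `x + s` are
distinct as soon as `L` exceeds the diameter of `S`.) -/
def interactionTerm {D d : ℕ} {S : Finset (Fin D → ℤ)} (g : Matrix (S → Fin d) (S → Fin d) ℂ)
    (L : ℕ) (x : Site D L) : Op D d L :=
  embed (fun s : S => fun i => x i + ((s : Fin D → ℤ) i : ZMod L)) g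

/-- The product state `ψ^{⊗ N}`. -/
def productState {d : ℕ} (ψ : Fin d → ℂ) (D L : ℕ) [NeZero L] : StateVec D d L :=
  fun σ => ∏ x, ψ (σ x)

/-- `Ψ` is an eigenvector of `H`. -/
def IsEigenstate {D d L : ℕ} [NeZero L] (H : Op D d L) (Ψ : StateVec D d L) : Prop :=
  ∃ E : ℂ, Module.End.HasEigenvector (Matrix.toLin' H) E Ψ

/-- The propagator `U_t = exp(-i H t)`. -/
def propagator {D d L : ℕ} [NeZero L] (H : Op D d L) (t : ℝ) : Op D d L :=
  NormedSpace.exp ((-(Complex.I * (t : ℂ))) • H)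

/-- The inner product `⟨Φ, A Ψ⟩`, antilinear in `Φ`. -/
def braket {D d L : ℕ} [NeZero L] (Φ : StateVec D d L) (A : Op D d L) (Ψ : StateVec D d L) : ℂ :=
  dotProduct (star Φ) (Matrix.mulVec A Ψ)

/-- The fidelity `F(t) = |⟨Ψ, U_t Ψ⟩|`. -/
def fidelity {D d L : ℕ} [NeZero L] (H : Op D d L) (Ψ : StateVec D d L) (t : ℝ) : ℝ :=
  ‖braket Ψ (propagator H t) Ψ‖

/-- The density matrix `U_t |Ψ⟩⟨Ψ| U_t†` of the evolved state. -/
def evolvedDensity {D d L : ℕ} [NeZero L] (H : Op D d L) (Ψ : StateVec D d L) (t : ℝ) :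
    Op D d L :=
  propagator H t * Matrix.vecMulVec Ψ (star Ψ) * (propagator H t).conjTranspose

/-- The partial trace over all sites except `x`. -/
def reducedDensity {D d L : ℕ} [NeZero L] (x : Site D L) (R : Op D d L) :
    Matrix (Fin d) (Fin d) ℂ :=
  Matrix.of fun a b => ∑ σ : Config D d L, if σ x = a then R σ (Function.update σ x b) else 0

/-- The operator `B ⊗ 1`, with `B` acting on the site `x`. -/
def onSite {D d L : ℕ} (x : Site D L) (B : Matrix (Fin d) (Fin d) ℂ) : Op D d L :=
  embed (fun _ : Unit => x) (Matrix.of fun a b => B (a ()) (b ()))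

/-- The expectation value `⟨Ψ| ρ_x(t) ⊗ 1 |Ψ⟩`, a number in `[0, 1]`. -/
def siteOverlap {D d L : ℕ} [NeZero L] (H : Op D d L) (Ψ : StateVec D d L) (x : Site D L)
    (t : ℝ) : ℝ :=
  (braket Ψ (onSite x (reducedDensity x (evolvedDensity H Ψ t))) Ψ).re

/-- `k(t) = -log ⟨Ψ| ρ_x(t) ⊗ 1 |Ψ⟩`, a number in `[0, ∞]`, with `-log 0 = ∞`. -/
def rate {D d L : ℕ} [NeZero L] (H : Op D d L) (Ψ : StateVec D d L) (x : Site D L) (t : ℝ) :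
    ℝ≥0∞ :=
  (-ENNReal.log (ENNReal.ofReal (siteOverlap H Ψ x t))).toENNReal

/-- `exp(-(1/4) (L^D k)^{1/(1+D)})`, which is `0` for `k = ∞`. -/
def decay (D L : ℕ) (k : ℝ≥0∞) : ℝ≥0∞ :=
  EReal.exp (-(((((L : ℝ≥0∞) ^ D * k) ^ (1 / (1 + (D : ℝ)))) / 4 : ℝ≥0∞) : EReal))

end SpinLattice

end

/-! Write P_S for the projection of every site of S onto ψ, and P_S(t) for its Heisenberg evolution.

Decay bound. Since |Ψ⟩⟨Ψ| ≤ P_S, one has F(t)² ≤ ⟨P_S(t)⟩ for every set S of sites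
(`fidelity_sq_le`). Take S to be a sublattice of m^D sites with spacing ℓ. By a Lieb–Robinson bound,
each P_x(t) lies within ε ~ L^D e^{-2R} of an operator on the ball of radius R around x
(`IsLocalHamiltonian.norm_heis_sub_localEvolution_le`). For 2R < ℓ these balls are disjoint, and
expectations in a product state factorize over disjoint regions (`expect_mul`), so F² ≤ e^{-k m^D} +
2 m^D ε. Let X = (L^D k)^{1/(1+D)} and ℓ ≈ X/2. Then m ≥ L/X, hence m^D k ≥ X, while the error is at
most a constant times L^{2D} e^{-X/2}. The lower bound k ≥ κ gives L^D ≤ X^{1+D}/κ, so half of the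
exponential pays for the volume factors and e^{-X/4} remains (`le_fidelityConst_mul_exp`).

Fixed interaction. The evolution localized in a box around a site is the same on every torus larger
than the box, so the single-site overlaps converge exponentially fast as L grows
(`exists_limit_siteOverlap`). If the limit is below 1, then k is eventually bounded below and the
previous bound applies. Otherwise k is exponentially small in L, X stays bounded, and F ≤ 1 suffices
with a large constant.

Small times. If k(t) = 0, translation invariance makes U_tΨ invariant under every P_x, hence
proportional to Ψ. The component of U_tΨ orthogonal to Ψ is analytic in t, and it vanishes
identically only when Ψ is an eigenvector. So the exceptional times are countable for each L, and
their union over L cannot fill (0, δ). -/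

noncomputable section

namespace SpinLattice

/-! ### Heisenberg evolution, Lieb–Robinson and Duhamel estimates in a C*-algebra. -/

section Heisenberg

variable {𝒜 : Type*} [CStarAlgebra 𝒜]

/-- The Heisenberg evolution `e^{iHt} a e^{-iHt}`. -/
def heis (H : 𝒜) (t : ℝ) (a : 𝒜) : 𝒜 :=
  NormedSpace.exp ((Complex.I * (t : ℂ)) • H) * a * NormedSpace.exp ((-(Complex.I * (t : ℂ))) • H)

theorem exp_smul_mem_unitary {H : 𝒜} (hH : IsSelfAdjoint H) (t : ℝ) :
    NormedSpace.exp ((Complex.I * (t : ℂ)) • H) ∈ unitary 𝒜 := by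
  let _ := NormedAlgebra.restrictScalars ℚ ℂ 𝒜
  apply NormedSpace.exp_mem_unitary_of_mem_skewAdjoint
  rw [skewAdjoint.mem_iff, star_smul, hH.star_eq]
  simp [neg_smul]

theorem exp_neg_smul_mem_unitary {H : 𝒜} (hH : IsSelfAdjoint H) (t : ℝ) :
    NormedSpace.exp ((-(Complex.I * (t : ℂ))) • H) ∈ unitary 𝒜 := by
  have := exp_smul_mem_unitary hH (-t)
  simpa using this

theorem exp_neg_mul_exp (z : ℂ) (H : 𝒜) :
    NormedSpace.exp ((-z) • H) * NormedSpace.exp (z • H) = 1 := by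
  let _ := NormedAlgebra.restrictScalars ℚ ℂ 𝒜
  rw [← NormedSpace.exp_add_of_commute, neg_smul, neg_add_cancel, NormedSpace.exp_zero]
  rw [neg_smul]
  exact (Commute.refl _).neg_left

theorem exp_mul_exp_neg (z : ℂ) (H : 𝒜) :
    NormedSpace.exp (z • H) * NormedSpace.exp ((-z) • H) = 1 := by
  simpa using exp_neg_mul_exp (-z) H

theorem star_exp_neg_smul {H : 𝒜} (hH : IsSelfAdjoint H) (t : ℝ) :
    star (NormedSpace.exp ((-(Complex.I * (t : ℂ))) • H)) =
      NormedSpace.exp ((Complex.I * (t : ℂ)) • H) := by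
  let _ := NormedAlgebra.restrictScalars ℚ ℂ 𝒜
  have h := Unitary.star_mul_self_of_mem (exp_neg_smul_mem_unitary hH t)
  calc _ = star (NormedSpace.exp ((-(Complex.I * (t : ℂ))) • H)) *
        (NormedSpace.exp ((-(Complex.I * (t : ℂ))) • H) *
          NormedSpace.exp ((Complex.I * (t : ℂ)) • H)) := by
        rw [exp_neg_mul_exp, mul_one]
    _ = _ := by rw [← mul_assoc, h, one_mul]

theorem norm_heis {H : 𝒜} (hH : IsSelfAdjoint H) (t : ℝ) (a : 𝒜) : ‖heis H t a‖ = ‖a‖ := by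
  unfold heis
  rw [CStarRing.norm_mul_mem_unitary _ (exp_neg_smul_mem_unitary hH t),
    CStarRing.norm_mem_unitary_mul _ (exp_smul_mem_unitary hH t)]

theorem heis_mul (H : 𝒜) (t : ℝ) (a b : 𝒜) : heis H t (a * b) = heis H t a * heis H t b := by
  unfold heis
  simp only [mul_assoc]
  rw [← mul_assoc (NormedSpace.exp ((-(Complex.I * (t : ℂ))) • H))
    (NormedSpace.exp ((Complex.I * (t : ℂ)) • H)), exp_neg_mul_exp, one_mul]

theorem heis_one (H : 𝒜) (t : ℝ) : heis H t 1 = 1 := by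
  rw [heis, mul_one, exp_mul_exp_neg]

theorem heis_sub (H : 𝒜) (t : ℝ) (a b : 𝒜) : heis H t (a - b) = heis H t a - heis H t b := by
  simp [heis, mul_sub, sub_mul]

theorem heis_sum {ι : Type*} (H : 𝒜) (t : ℝ) (s : Finset ι) (a : ι → 𝒜) :
    heis H t (∑ i ∈ s, a i) = ∑ i ∈ s, heis H t (a i) := by
  simp [heis, Finset.mul_sum, Finset.sum_mul]

theorem heis_zero_time (H : 𝒜) (a : 𝒜) : heis H 0 a = a := by
  simp [heis]

theorem map_heis {ℬ : Type*} [CStarAlgebra ℬ] (f : 𝒜 →ₐ[ℂ] ℬ) (hf : Continuous f) (H a : 𝒜)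
    (t : ℝ) : f (heis H t a) = heis (f H) t (f a) := by
  let _ := NormedAlgebra.restrictScalars ℚ ℂ 𝒜
  let _ := NormedAlgebra.restrictScalars ℚ ℂ ℬ
  simp only [heis, map_mul]
  rw [NormedSpace.map_exp _ hf, NormedSpace.map_exp _ hf, map_smul, map_smul]

theorem Commute.heis {H a q : 𝒜} (hH : Commute q H) (ha : Commute q a) (t : ℝ) :
    Commute q (heis H t a) :=
  ((hH.smul_right _).exp_right.mul_right ha).mul_right (hH.smul_right _).exp_right

theorem hasDerivAt_exp_I_smul (H : 𝒜) (t : ℝ) :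
    HasDerivAt (fun s : ℝ => NormedSpace.exp ((Complex.I * (s : ℂ)) • H))
      (NormedSpace.exp ((Complex.I * (t : ℂ)) • H) * (Complex.I • H)) t := by
  have := hasDerivAt_exp_smul_const (𝕂 := ℝ) (Complex.I • H) t
  have e : ∀ s : ℝ, s • (Complex.I • H) = (Complex.I * (s : ℂ)) • H := fun s => by
    rw [mul_comm, mul_smul, Complex.coe_smul]
  simpa only [e] using this

theorem hasDerivAt_exp_neg_I_smul (H : 𝒜) (t : ℝ) :
    HasDerivAt (fun s : ℝ => NormedSpace.exp ((-(Complex.I * (s : ℂ))) • H))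
      (-(Complex.I • H) * NormedSpace.exp ((-(Complex.I * (t : ℂ))) • H)) t := by
  have := hasDerivAt_exp_smul_const' (𝕂 := ℝ) (-(Complex.I • H)) t
  have e : ∀ s : ℝ, s • (-(Complex.I • H)) = (-(Complex.I * (s : ℂ))) • H := fun s => by
    rw [smul_neg, neg_smul, mul_comm, mul_smul, Complex.coe_smul]
  simpa only [e] using this

theorem hasDerivAt_heis (H a : 𝒜) (t : ℝ) :
    HasDerivAt (fun s => heis H s a) (Complex.I • heis H t (H * a - a * H)) t := by
  unfold heis
  refine (((hasDerivAt_exp_I_smul H t).mul_const a).mul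
    (hasDerivAt_exp_neg_I_smul H t)).congr_deriv ?_
  simp only [mul_sub, sub_mul, smul_sub, mul_smul_comm, smul_mul_assoc, neg_mul, mul_neg, mul_assoc]
  abel

/-- A Lieb–Robinson bound: commutators of the evolved local terms with a fixed observable
remain small where they are initially small, relative to a weight that varies slowly along the
interaction graph. -/
theorem norm_commutator_heis_le {ι : Type*} [Fintype ι] (h : ι → 𝒜) (nb : ι → Finset ι)
    (w : ι → ℝ) {J Γ M : ℝ} {V : ℕ} (A : 𝒜)
    (hsa : ∀ z, IsSelfAdjoint (h z)) (hJ : ∀ z, ‖h z‖ ≤ J) (hJ0 : 0 ≤ J)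
    (hnb : ∀ z y, y ∉ nb z → Commute (h y) (h z)) (hV : ∀ z, (nb z).card ≤ V)
    (hw : ∀ z, 0 < w z) (hΓ : ∀ z, ∀ y ∈ nb z, w z ≤ Γ * w y)
    (hΓ0 : 0 ≤ Γ) (hM : ∀ z, w z * ‖h z * A - A * h z‖ ≤ M) (hM0 : 0 ≤ M)
    {t : ℝ} (ht : 0 ≤ t) (z : ι) :
    w z * ‖heis (∑ y, h y) t (h z) * A - A * heis (∑ y, h y) t (h z)‖ ≤
      M * Real.exp (2 * J * V * (1 + Γ) * t) := by
  set H := ∑ y, h y with hHdef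
  have hH : IsSelfAdjoint H := by
    rw [hHdef]; exact isSelfAdjoint_sum _ fun i _ => hsa i
  -- All weighted commutators are collected in one curve in `ι → 𝒜` with the sup norm, so that the
  -- coupled differential inequalities become a single Grönwall inequality.
  set f : ℝ → ι → 𝒜 := fun s z => w z • (heis H s (h z) * A - A * heis H s (h z)) with hf
  set f' : ℝ → ι → 𝒜 := fun s z => w z • ((Complex.I • heis H s (H * h z - h z * H)) * A
    - A * (Complex.I • heis H s (H * h z - h z * H))) with hf'
  have hder : ∀ s, HasDerivAt f (f' s) s := by
    intro s
    rw [hasDerivAt_pi]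
    intro z
    have h1 := hasDerivAt_heis H (h z) s
    exact ((h1.mul_const A).sub (h1.const_mul A)).const_smul (w z)
  have hcomm : ∀ z, H * h z - h z * H = ∑ y ∈ nb z, (h y * h z - h z * h y) := by
    intro z
    rw [hHdef, Finset.sum_mul, Finset.mul_sum, ← Finset.sum_sub_distrib]
    symm
    apply Finset.sum_subset (Finset.subset_univ _)
    intro y _ hy
    exact sub_eq_zero.2 (hnb z y hy).eq
  have hbound : ∀ s, ‖f' s‖ ≤ (2 * J * V * (1 + Γ)) * ‖f s‖ + 0 := by
    intro s
    rw [add_zero]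
    have hK : 0 ≤ 2 * J * V * (1 + Γ) := by positivity
    rw [pi_norm_le_iff_of_nonneg (mul_nonneg hK (norm_nonneg _))]
    intro z
    have hfz : ∀ y, w y * ‖heis H s (h y) * A - A * heis H s (h y)‖ ≤ ‖f s‖ := by
      intro y
      have := norm_le_pi_norm (f s) y
      simpa only [hf, norm_smul, Real.norm_of_nonneg (hw y).le] using this
    -- Jacobi identity: [[h_y, h_z], A] = [h_y, [h_z, A]] − [h_z, [h_y, A]], where only the
    -- neighbours y of z contribute. The derivative is thus linear in the quantities being
    -- estimated.
    have e : f' s z = Complex.I • ∑ y ∈ nb z, w z •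
        ((heis H s (h y) * (heis H s (h z) * A - A * heis H s (h z)) -
          (heis H s (h z) * A - A * heis H s (h z)) * heis H s (h y)) -
        (heis H s (h z) * (heis H s (h y) * A - A * heis H s (h y)) -
          (heis H s (h y) * A - A * heis H s (h y)) * heis H s (h z))) := by
      simp only [hf', hcomm, heis_sum, heis_sub, heis_mul]
      rw [smul_mul_assoc, mul_smul_comm, ← smul_sub, smul_comm (w z) Complex.I, ← Finset.smul_sum,
        Finset.sum_mul, Finset.mul_sum, ← Finset.sum_sub_distrib]
      congr 2
      refine Finset.sum_congr rfl fun y _ => ?_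
      noncomm_ring
    rw [e, norm_smul, Complex.norm_I, one_mul]
    have hterm : ∀ y ∈ nb z, ‖w z •
        ((heis H s (h y) * (heis H s (h z) * A - A * heis H s (h z)) -
          (heis H s (h z) * A - A * heis H s (h z)) * heis H s (h y)) -
        (heis H s (h z) * (heis H s (h y) * A - A * heis H s (h y)) -
          (heis H s (h y) * A - A * heis H s (h y)) * heis H s (h z)))‖ ≤
        2 * J * (1 + Γ) * ‖f s‖ := by
      intro y hy
      rw [norm_smul, Real.norm_of_nonneg (hw z).le]
      have hn : ∀ a b : 𝒜, ‖a‖ ≤ J → ‖a * b - b * a‖ ≤ 2 * J * ‖b‖ := by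
        intro a b ha
        calc ‖a * b - b * a‖ ≤ ‖a‖ * ‖b‖ + ‖b‖ * ‖a‖ :=
              (norm_sub_le _ _).trans (add_le_add (norm_mul_le _ _) (norm_mul_le _ _))
          _ = 2 * ‖a‖ * ‖b‖ := by ring
          _ ≤ _ := by gcongr
      have hy1 : ‖heis H s (h y)‖ ≤ J := (norm_heis hH s _).trans_le (hJ y)
      have hz1 : ‖heis H s (h z)‖ ≤ J := (norm_heis hH s _).trans_le (hJ z)
      have b1 := hn _ (heis H s (h z) * A - A * heis H s (h z)) hy1
      have b2 := hn _ (heis H s (h y) * A - A * heis H s (h y)) hz1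
      have c1 := hfz z
      have c2 : w z * ‖heis H s (h y) * A - A * heis H s (h y)‖ ≤ Γ * ‖f s‖ :=
        calc _ ≤ Γ * w y * ‖heis H s (h y) * A - A * heis H s (h y)‖ := by
              gcongr; exact hΓ z y hy
          _ = Γ * (w y * ‖heis H s (h y) * A - A * heis H s (h y)‖) := by ring
          _ ≤ _ := by gcongr; exact hfz y
      calc _ ≤ w z * (2 * J * ‖heis H s (h z) * A - A * heis H s (h z)‖ +
              2 * J * ‖heis H s (h y) * A - A * heis H s (h y)‖) := by
            have := (hw z).le
            gcongr
            exact (norm_sub_le _ _).trans (add_le_add b1 b2)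
        _ = 2 * J * (w z * ‖heis H s (h z) * A - A * heis H s (h z)‖ +
              w z * ‖heis H s (h y) * A - A * heis H s (h y)‖) := by ring
        _ ≤ 2 * J * (‖f s‖ + Γ * ‖f s‖) := by gcongr
        _ = _ := by ring
    calc _ ≤ ∑ y ∈ nb z, 2 * J * (1 + Γ) * ‖f s‖ :=
          (norm_sum_le _ _).trans (Finset.sum_le_sum hterm)
      _ = (nb z).card * (2 * J * (1 + Γ) * ‖f s‖) := by rw [Finset.sum_const, nsmul_eq_mul]
      _ ≤ V * (2 * J * (1 + Γ) * ‖f s‖) := by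
          gcongr
          exact hV z
      _ = _ := by ring
  have hinit : ‖f 0‖ ≤ M := by
    rw [pi_norm_le_iff_of_nonneg hM0]
    intro z
    simp only [hf, heis_zero_time, norm_smul, Real.norm_of_nonneg (hw z).le]
    exact hM z
  have key := norm_le_gronwallBound_of_norm_deriv_right_le (f := f) (f' := f') (a := 0) (b := t)
    (fun s _ => (hder s).continuousAt.continuousWithinAt)
    (fun s _ => (hder s).hasDerivWithinAt) hinit (fun s _ => hbound s) t ⟨ht, le_rfl⟩
  rw [gronwallBound_ε0, sub_zero] at key
  refine le_trans ?_ key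
  have := norm_le_pi_norm (f t) z
  simpa only [hf, norm_smul, Real.norm_of_nonneg (hw z).le] using this

theorem heis_neg (H : 𝒜) (t : ℝ) (a : 𝒜) : heis (-H) t a = heis H (-t) a := by
  simp [heis]

theorem heis_heis_neg (H : 𝒜) (t : ℝ) (a : 𝒜) : heis H t (heis H (-t) a) = a := by
  unfold heis
  simp only [Complex.ofReal_neg, mul_neg, neg_neg]
  rw [show ∀ x y b : 𝒜, x * (y * b * x) * y = (x * y) * b * (x * y) from fun x y b => by
    simp only [mul_assoc], exp_mul_exp_neg, one_mul, mul_one]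

/-- Conjugation by the unitary evolution is isometric, so the evolution can be moved from one entry
of a commutator to the other at the price of reversing time. -/
theorem norm_commutator_heis_neg {H : 𝒜} (hH : IsSelfAdjoint H) (t : ℝ) (a b : 𝒜) :
    ‖a * heis H t b - heis H t b * a‖ = ‖heis H (-t) a * b - b * heis H (-t) a‖ := by
  rw [← norm_heis hH t (heis H (-t) a * b - b * heis H (-t) a), heis_sub, heis_mul, heis_mul,
    heis_heis_neg]

/-- Duhamel's estimate for the difference of two Heisenberg evolutions. -/
theorem norm_heis_sub_heis_le {H H' : 𝒜} (hH' : IsSelfAdjoint H') (a : 𝒜)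
    {t ε : ℝ} (ht : 0 ≤ t)
    (hε : ∀ s, 0 ≤ s → s ≤ t → ‖(H - H') * heis H s a - heis H s a * (H - H')‖ ≤ ε) :
    ‖heis H t a - heis H' t a‖ ≤ t * ε := by
  -- G interpolates by evolving forward with H and backward with H'. Its derivative is a unitary
  -- conjugate of i[H − H', a(s)], and G t − G 0 is a unitary conjugate of the difference to be
  -- estimated.
  set G : ℝ → 𝒜 := fun s => NormedSpace.exp ((-(Complex.I * (s : ℂ))) • H') * heis H s a *
    NormedSpace.exp ((Complex.I * (s : ℂ)) • H') with hG
  set G' : ℝ → 𝒜 := fun s => NormedSpace.exp ((-(Complex.I * (s : ℂ))) • H') *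
    (Complex.I • ((H - H') * heis H s a - heis H s a * (H - H'))) *
    NormedSpace.exp ((Complex.I * (s : ℂ)) • H') with hG'
  have hder : ∀ s, HasDerivAt G (G' s) s := by
    intro s
    have hc : Commute H' (NormedSpace.exp ((-(Complex.I * (s : ℂ))) • H')) :=
      ((Commute.refl H').smul_right _).exp_right
    have hc' : Commute H' (NormedSpace.exp ((Complex.I * (s : ℂ)) • H')) :=
      ((Commute.refl H').smul_right _).exp_right
    have hHe : heis H s (H * a - a * H) = H * heis H s a - heis H s a * H := by
      have e1 : heis H s H = H := by
        have : Commute H (NormedSpace.exp ((Complex.I * (s : ℂ)) • H)) :=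
          ((Commute.refl H).smul_right _).exp_right
        unfold heis
        rw [← this.eq, mul_assoc, exp_mul_exp_neg, mul_one]
      rw [heis_sub, heis_mul, heis_mul, e1]
    refine (((hasDerivAt_exp_neg_I_smul H' s).mul (hasDerivAt_heis H a s)).mul
      (hasDerivAt_exp_I_smul H' s)).congr_deriv ?_
    simp only [hG', hHe]
    rw [← (hc'.smul_left Complex.I).eq, neg_mul, (hc.smul_left Complex.I).eq]
    simp only [mul_sub, sub_mul, smul_sub, mul_smul_comm, smul_mul_assoc, neg_mul, add_mul,
      mul_assoc, Pi.mul_apply]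
    abel
  have hn : ∀ (s : ℝ) (x : 𝒜), ‖NormedSpace.exp ((-(Complex.I * (s : ℂ))) • H') * x *
      NormedSpace.exp ((Complex.I * (s : ℂ)) • H')‖ = ‖x‖ := by
    intro s x
    rw [CStarRing.norm_mul_mem_unitary _ (exp_smul_mem_unitary hH' s),
      CStarRing.norm_mem_unitary_mul _ (exp_neg_smul_mem_unitary hH' s)]
  have key := (convex_Icc (0 : ℝ) t).norm_image_sub_le_of_norm_hasDerivWithin_le
    (f := G) (f' := G') (C := ε) (x := 0) (y := t)
    (fun s _ => (hder s).hasDerivWithinAt)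
    (fun s hs => by
      simp only [hG']
      rw [hn, norm_smul, Complex.norm_I, one_mul]
      exact hε s hs.1 hs.2) ⟨le_rfl, ht⟩ ⟨ht, le_rfl⟩
  have e : G t - G 0 = NormedSpace.exp ((-(Complex.I * (t : ℂ))) • H') *
      (heis H t a - heis H' t a) * NormedSpace.exp ((Complex.I * (t : ℂ)) • H') := by
    have e0 : G 0 = a := by simp [hG, heis_zero_time]
    have e1 : NormedSpace.exp ((-(Complex.I * (t : ℂ))) • H') * heis H' t a *
        NormedSpace.exp ((Complex.I * (t : ℂ)) • H') = a := by
      have := heis_heis_neg H' (-t) a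
      rw [neg_neg] at this
      conv_rhs => rw [← this]
      conv_rhs => rw [heis]
      simp
    rw [mul_sub, sub_mul, e1, e0]
  rw [e, hn, sub_zero, Real.norm_of_nonneg ht, mul_comm] at key
  exact key

theorem norm_commutator_le {a b : 𝒜} {J : ℝ} (ha : ‖a‖ ≤ J) (hb : ‖b‖ ≤ 1) :
    ‖a * b - b * a‖ ≤ 2 * J :=
  calc ‖a * b - b * a‖ ≤ ‖a‖ * ‖b‖ + ‖b‖ * ‖a‖ :=
        (norm_sub_le _ _).trans (add_le_add (norm_mul_le _ _) (norm_mul_le _ _))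
    _ = 2 * (‖a‖ * ‖b‖) := by ring
    _ ≤ 2 * (J * 1) := by have := (norm_nonneg a).trans ha; gcongr
    _ = 2 * J := by ring

/-- The evolution of an observable is approximated by the evolution under the terms near it. -/
theorem norm_heis_sub_heis_sum_le {ι : Type*} [Fintype ι] (h : ι → 𝒜) (nb : ι → Finset ι)
    (w : ι → ℝ) {J Γ M W : ℝ} {V : ℕ} (A : 𝒜) (B : Finset ι)
    (hsa : ∀ z, IsSelfAdjoint (h z)) (hJ : ∀ z, ‖h z‖ ≤ J) (hJ0 : 0 ≤ J)
    (hnb : ∀ z y, y ∉ nb z → Commute (h y) (h z)) (hV : ∀ z, (nb z).card ≤ V)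
    (hw : ∀ z, 0 < w z) (hΓ : ∀ z, ∀ y ∈ nb z, w z ≤ Γ * w y)
    (hΓ0 : 0 ≤ Γ) (hM : ∀ z, w z * ‖h z * A - A * h z‖ ≤ M) (hM0 : 0 ≤ M)
    (hW : ∀ z, z ∉ B → W ≤ w z) (hW0 : 0 < W) {t : ℝ} (ht : 0 ≤ t) :
    ‖heis (∑ y, h y) t A - heis (∑ y ∈ B, h y) t A‖ ≤
      t * (Fintype.card ι * (M * Real.exp (2 * J * V * (1 + Γ) * t) / W)) := by
  classical
  apply norm_heis_sub_heis_le (isSelfAdjoint_sum _ fun i _ => hsa i) A ht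
  intro s hs0 hst
  have hsub : ∑ y, h y - ∑ y ∈ B, h y = ∑ y ∈ Bᶜ, h y := by
    rw [← Finset.sum_add_sum_compl B, add_sub_cancel_left]
  rw [hsub, Finset.sum_mul, Finset.mul_sum, ← Finset.sum_sub_distrib]
  have hH : IsSelfAdjoint (∑ y, h y) := isSelfAdjoint_sum _ fun i _ => hsa i
  have hterm : ∀ z ∈ Bᶜ, ‖h z * heis (∑ y, h y) s A - heis (∑ y, h y) s A * h z‖ ≤
      M * Real.exp (2 * J * V * (1 + Γ) * t) / W := by
    intro z hz
    -- Moving the evolution onto h_z reverses time, whereas the Lieb–Robinson bound is for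
    -- nonnegative times; the sign is absorbed by applying it to the terms −h_z.
    have h1 := norm_commutator_heis_le (fun z => - h z) nb w A (fun z => (hsa z).neg)
      (fun z => by rw [norm_neg]; exact hJ z) hJ0
      (fun z y hy => ((hnb z y hy).neg_left).neg_right) hV hw hΓ hΓ0
      (fun z => by
        rw [show -h z * A - A * -h z = -(h z * A - A * h z) by noncomm_ring, norm_neg]
        exact hM z) hM0 hs0 z
    have e : heis (∑ y, -h y) s (-h z) = -heis (∑ y, h y) (-s) (h z) := by
      rw [Finset.sum_neg_distrib, heis_neg]
      simp only [heis, mul_neg, neg_mul]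
    rw [e, show ∀ b : 𝒜, -b * A - A * -b = -(b * A - A * b) from fun b => by noncomm_ring,
      norm_neg, ← norm_commutator_heis_neg hH] at h1
    rw [le_div_iff₀ hW0, mul_comm]
    calc _ ≤ w z * ‖h z * heis (∑ y, h y) s A - heis (∑ y, h y) s A * h z‖ := by
          gcongr; exact hW z (by simpa using hz)
      _ ≤ _ := h1
      _ ≤ _ := by gcongr
  calc _ ≤ ∑ z ∈ Bᶜ, M * Real.exp (2 * J * V * (1 + Γ) * t) / W :=
        (norm_sum_le _ _).trans (Finset.sum_le_sum hterm)
    _ = (Bᶜ).card * (M * Real.exp (2 * J * V * (1 + Γ) * t) / W) := by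
        rw [Finset.sum_const, nsmul_eq_mul]
    _ ≤ _ := by
        gcongr
        exact Finset.card_le_univ _

theorem norm_mul_sub_mul_le_of_norm_le_one {a b A C : 𝒜} {δ ε : ℝ} (ha : ‖a‖ ≤ 1) (hC : ‖C‖ ≤ 1)
    (hb : ‖b - C‖ ≤ δ) (hA : ‖a - A‖ ≤ ε) : ‖a * b - A * C‖ ≤ δ + ε := by
  have e : a * b - A * C = a * (b - C) + (a - A) * C := by noncomm_ring
  rw [e]
  calc _ ≤ ‖a‖ * ‖b - C‖ + ‖a - A‖ * ‖C‖ :=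
        (norm_add_le _ _).trans (add_le_add (norm_mul_le _ _) (norm_mul_le _ _))
    _ ≤ 1 * δ + ε * 1 := by
        have := (norm_nonneg _).trans hA
        gcongr
    _ = _ := by ring

theorem norm_mul_le_one {a b : 𝒜} (ha : ‖a‖ ≤ 1) (hb : ‖b‖ ≤ 1) : ‖a * b‖ ≤ 1 :=
  (norm_mul_le _ _).trans (mul_le_one₀ ha (norm_nonneg _) hb)

end Heisenberg

/-! ### Operators on part of a tensor product. -/

section Embedding

open Classical in
/-- The operator on `(ℂ^d)^{⊗ T}` that acts as `B` on the tensor factors in the range of the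
injective map `ι : S → T` and as the identity on the others. -/
def tensorEmbed {d : ℕ} {S T : Type} (ι : S → T) (B : Matrix (S → Fin d) (S → Fin d) ℂ) :
    Matrix (T → Fin d) (T → Fin d) ℂ :=
  Matrix.of fun σ σ' =>
    if ∀ y, y ∉ Set.range ι → σ y = σ' y then B (fun s => σ (ι s)) (fun s => σ' (ι s)) else 0

theorem embed_eq_tensorEmbed {D d L : ℕ} {S : Type} (ι : S → Site D L)
    (B : Matrix (S → Fin d) (S → Fin d) ℂ) : embed ι B = tensorEmbed ι B := rfl

variable {d : ℕ} {S S₁ S₂ T : Type}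

-- Only one intermediate configuration contributes to the matrix product: the one equal to σ' on the
-- range of ι₁ and to σ elsewhere. The result is symmetric in the two factors, which gives
-- `commute_tensorEmbed`.
open Classical in
theorem tensorEmbed_mul_apply_of_disjoint [Fintype T] [DecidableEq T] {ι₁ : S₁ → T} {ι₂ : S₂ → T}
    (hd : Disjoint (Set.range ι₁) (Set.range ι₂)) (B : Matrix (S₁ → Fin d) (S₁ → Fin d) ℂ)
    (C : Matrix (S₂ → Fin d) (S₂ → Fin d) ℂ) (σ σ' : T → Fin d) :
    (tensorEmbed ι₁ B * tensorEmbed ι₂ C) σ σ' =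
      if ∀ y, y ∉ Set.range ι₁ → y ∉ Set.range ι₂ → σ y = σ' y then
        B (fun s => σ (ι₁ s)) (fun s => σ' (ι₁ s)) * C (fun s => σ (ι₂ s)) (fun s => σ' (ι₂ s))
      else 0 := by
  rw [Set.disjoint_left] at hd
  rw [Matrix.mul_apply, Finset.sum_eq_single (fun y => if y ∈ Set.range ι₁ then σ' y else σ y)]
  · simp only [tensorEmbed, Matrix.of_apply]
    rw [if_pos (by intro y hy; rw [if_neg hy])]
    by_cases h : ∀ y, y ∉ Set.range ι₁ → y ∉ Set.range ι₂ → σ y = σ' y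
    · rw [if_pos h, if_pos]
      · congr 2
        · funext s; simp
        · funext s; rw [if_neg fun h' => hd h' ⟨s, rfl⟩]
      · intro y hy
        split_ifs with h'
        · rfl
        · exact h y h' hy
    · rw [if_neg h, if_neg, mul_zero]
      intro h'
      apply h
      intro y h1 h2
      have := h' y h2
      rwa [if_neg h1] at this
  · intro η _ hη
    simp only [tensorEmbed, Matrix.of_apply]
    by_contra hne
    apply hη
    have h1 : ∀ y, y ∉ Set.range ι₁ → σ y = η y := by
      by_contra h; rw [if_neg h, zero_mul] at hne; exact hne rfl
    have h2 : ∀ y, y ∉ Set.range ι₂ → η y = σ' y := by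
      by_contra h; rw [if_neg h, mul_zero] at hne; exact hne rfl
    funext y
    split_ifs with hy
    · exact h2 y (hd hy)
    · exact (h1 y hy).symm
  · simp

theorem commute_tensorEmbed [Fintype T] [DecidableEq T] {ι₁ : S₁ → T} {ι₂ : S₂ → T}
    (hd : Disjoint (Set.range ι₁) (Set.range ι₂)) (B : Matrix (S₁ → Fin d) (S₁ → Fin d) ℂ)
    (C : Matrix (S₂ → Fin d) (S₂ → Fin d) ℂ) :
    Commute (tensorEmbed ι₁ B) (tensorEmbed ι₂ C) := by
  classical
  ext σ σ'
  rw [tensorEmbed_mul_apply_of_disjoint hd, tensorEmbed_mul_apply_of_disjoint hd.symm]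
  have : (∀ y, y ∉ Set.range ι₁ → y ∉ Set.range ι₂ → σ y = σ' y) ↔
      ∀ y, y ∉ Set.range ι₂ → y ∉ Set.range ι₁ → σ y = σ' y :=
    forall_congr' fun y => ⟨fun h a b => h b a, fun h a b => h b a⟩
  rw [if_congr this rfl rfl, mul_comm]

theorem tensorEmbed_comp {T' : Type} {κ : T → T'} (hκ : Function.Injective κ) (ι : S → T)
    (B : Matrix (S → Fin d) (S → Fin d) ℂ) :
    tensorEmbed κ (tensorEmbed ι B) = tensorEmbed (κ ∘ ι) B := by
  classical
  ext σ σ'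
  simp only [tensorEmbed, Matrix.of_apply, Function.comp_apply]
  by_cases h : ∀ y, y ∉ Set.range (κ ∘ ι) → σ y = σ' y
  · rw [if_pos h, if_pos, if_pos]
    · intro y hy
      apply h
      rintro ⟨s, hs⟩
      exact hy ⟨s, hκ hs⟩
    · intro y hy
      apply h
      rintro ⟨s, hs⟩
      exact hy ⟨ι s, hs⟩
  · rw [if_neg h]
    by_cases h1 : ∀ y, y ∉ Set.range κ → σ y = σ' y
    · rw [if_pos h1, if_neg]
      intro h2
      apply h
      intro y hy
      by_cases hy' : y ∈ Set.range κ
      · obtain ⟨x, rfl⟩ := hy'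
        apply h2
        rintro ⟨s, rfl⟩
        exact hy ⟨s, rfl⟩
      · exact h1 y hy'
    · rw [if_neg h1]

open Classical in
/-- Configurations on `T`, split into configurations on the range of `ι` and on the rest. -/
def splitConfig {ι : S → T} (hι : Function.Injective ι) :
    (T → Fin d) ≃ (S → Fin d) × ({y : T // y ∉ Set.range ι} → Fin d) where
  toFun σ := (fun s => σ (ι s), fun y => σ y)
  invFun p := fun y => if h : y ∈ Set.range ι then p.1 h.choose else p.2 ⟨y, h⟩
  left_inv σ := by
    funext y
    by_cases h : y ∈ Set.range ι
    · simp only [dif_pos h]; rw [h.choose_spec]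
    · simp only [dif_neg h]
  right_inv p := by
    refine Prod.ext ?_ ?_
    · funext s
      have h : ι s ∈ Set.range ι := ⟨s, rfl⟩
      simp only [dif_pos h]
      rw [hι h.choose_spec]
    · funext y
      simp only [dif_neg y.2]

-- Once configurations are split into the range of ι and its complement, the embedding is B ⊗ 1; all
-- algebraic properties of `tensorEmbedHom` come from this form.
open scoped Kronecker in
theorem tensorEmbed_eq_submatrix {ι : S → T} (hι : Function.Injective ι)
    [DecidableEq ({y : T // y ∉ Set.range ι} → Fin d)] (B : Matrix (S → Fin d) (S → Fin d) ℂ) :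
    tensorEmbed ι B = (B ⊗ₖ (1 : Matrix ({y : T // y ∉ Set.range ι} → Fin d) _ ℂ)).submatrix
      (splitConfig hι) (splitConfig hι) := by
  classical
  ext σ σ'
  simp only [tensorEmbed, Matrix.of_apply, Matrix.submatrix_apply, Matrix.kroneckerMap_apply,
    splitConfig, Equiv.coe_fn_mk, Matrix.one_apply]
  rw [mul_ite, mul_one, mul_zero]
  refine if_congr ?_ rfl rfl
  rw [funext_iff]
  exact ⟨fun h y => h y y.2, fun h y hy => h ⟨y, hy⟩⟩

variable [Fintype S] [DecidableEq S] [Fintype T] [DecidableEq T]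

open Classical in
open scoped Kronecker in
/-- `tensorEmbed` as a homomorphism of star algebras. -/
def tensorEmbedHom {ι : S → T} (hι : Function.Injective ι) :
    Matrix (S → Fin d) (S → Fin d) ℂ →⋆ₐ[ℂ] Matrix (T → Fin d) (T → Fin d) ℂ where
  toFun := tensorEmbed ι
  map_one' := by
    rw [tensorEmbed_eq_submatrix hι, Matrix.one_kronecker_one, Matrix.submatrix_one_equiv]
  map_mul' B C := by
    simp only [tensorEmbed_eq_submatrix hι]
    rw [Matrix.submatrix_mul_equiv, ← Matrix.mul_kronecker_mul, Matrix.one_mul]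
  map_zero' := by
    rw [tensorEmbed_eq_submatrix hι, Matrix.zero_kronecker, Matrix.submatrix_zero]; rfl
  map_add' B C := by
    simp only [tensorEmbed_eq_submatrix hι]
    rw [Matrix.add_kronecker]; rfl
  commutes' z := by
    rw [Algebra.algebraMap_eq_smul_one, Algebra.algebraMap_eq_smul_one,
      tensorEmbed_eq_submatrix hι, Matrix.smul_kronecker, Matrix.one_kronecker_one,
      Matrix.submatrix_smul, Pi.smul_apply, Pi.smul_apply, Matrix.submatrix_one_equiv]
  map_star' B := by
    simp only [tensorEmbed_eq_submatrix hι, Matrix.star_eq_conjTranspose]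
    rw [Matrix.conjTranspose_submatrix, Matrix.conjTranspose_kronecker, Matrix.conjTranspose_one]

theorem tensorEmbedHom_apply {ι : S → T} (hι : Function.Injective ι)
    (B : Matrix (S → Fin d) (S → Fin d) ℂ) : tensorEmbedHom hι B = tensorEmbed ι B := rfl

open scoped Matrix.Norms.L2Operator in
theorem norm_tensorEmbed_le {ι : S → T} (hι : Function.Injective ι)
    (B : Matrix (S → Fin d) (S → Fin d) ℂ) : ‖tensorEmbed ι B‖ ≤ ‖B‖ :=
  NonUnitalStarAlgHom.norm_apply_le (tensorEmbedHom hι) B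

open scoped Matrix.Norms.L2Operator in
theorem tensorEmbed_heis {ι : S → T} (hι : Function.Injective ι)
    (H B : Matrix (S → Fin d) (S → Fin d) ℂ) (t : ℝ) :
    tensorEmbed ι (heis H t B) = heis (tensorEmbed ι H) t (tensorEmbed ι B) := by
  exact map_heis (tensorEmbedHom (d := d) hι).toAlgHom
    (tensorEmbedHom (d := d) hι).toLinearMap.continuous_of_finiteDimensional H B t

/-- The vector `ψ^{⊗ T}`. -/
def tensorPower (ψ : Fin d → ℂ) (T : Type) [Fintype T] : (T → Fin d) → ℂ :=
  fun σ => ∏ y, ψ (σ y)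

/-- The product operator with factors `M y`. -/
def prodOp (M : T → Matrix (Fin d) (Fin d) ℂ) : Matrix (T → Fin d) (T → Fin d) ℂ :=
  Matrix.of fun σ σ' => ∏ y, M y (σ y) (σ' y)

theorem prodOp_mul (M N : T → Matrix (Fin d) (Fin d) ℂ) :
    prodOp M * prodOp N = prodOp (fun y => M y * N y) := by
  ext σ σ'
  simp only [Matrix.mul_apply, prodOp, Matrix.of_apply]
  rw [Finset.prod_univ_sum, Fintype.piFinset_univ]
  simp only [Finset.prod_mul_distrib]

theorem star_tensorPower_dotProduct (ψ : Fin d → ℂ) (hψ : ∑ i, ‖ψ i‖ ^ 2 = 1) :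
    dotProduct (star (tensorPower ψ T)) (tensorPower ψ T) = 1 := by
  have h1 : ∑ i, star (ψ i) * ψ i = 1 := by
    have : ∀ i, star (ψ i) * ψ i = ((‖ψ i‖ ^ 2 : ℝ) : ℂ) := fun i => by
      rw [Complex.star_def, Complex.conj_mul']; push_cast; rfl
    simp only [this, ← Complex.ofReal_sum, hψ, Complex.ofReal_one]
  have h2 : (∏ _y : T, ∑ i, star (ψ i) * ψ i) = 1 := by rw [Finset.prod_congr rfl fun _ _ => h1, Finset.prod_const_one]
  rw [Finset.prod_univ_sum, Fintype.piFinset_univ] at h2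
  rw [← h2, dotProduct]
  refine Finset.sum_congr rfl fun σ _ => ?_
  simp [tensorPower, Finset.prod_mul_distrib]

theorem tensorPower_split (ψ : Fin d → ℂ) {ι : S → T} (hι : Function.Injective ι)
    [Fintype {y : T // y ∉ Set.range ι}]
    (p : (S → Fin d) × ({y : T // y ∉ Set.range ι} → Fin d)) :
    tensorPower ψ T ((splitConfig hι).symm p) =
      tensorPower ψ S p.1 * tensorPower ψ {y : T // y ∉ Set.range ι} p.2 := by
  classical
  obtain ⟨σ, rfl⟩ := (splitConfig hι).surjective p
  rw [Equiv.symm_apply_apply]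
  simp only [tensorPower, splitConfig, Equiv.coe_fn_mk]
  rw [← Fintype.prod_subtype_mul_prod_subtype (fun y => y ∈ Set.range ι) (fun y => ψ (σ y))]
  congr 1
  · exact Eq.trans (Finset.prod_congr (by ext; simp) fun _ _ => rfl)
      (Fintype.prod_equiv (Equiv.ofInjective ι hι) (fun s => ψ (σ (ι s)))
        (fun y => ψ (σ y)) fun s => rfl).symm
  · exact Finset.prod_congr (by ext; simp) fun _ _ => rfl

/-- The product vector factorizes along `splitConfig`, and the untouched factors contribute their
norm, which is one. Expectations therefore do not see the size of the surrounding system; the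
comparison of different tori rests on this. -/
theorem expectation_tensorEmbed (ψ : Fin d → ℂ) (hψ : ∑ i, ‖ψ i‖ ^ 2 = 1) {ι : S → T}
    (hι : Function.Injective ι) (B : Matrix (S → Fin d) (S → Fin d) ℂ) :
    dotProduct (star (tensorPower ψ T)) (Matrix.mulVec (tensorEmbed ι B) (tensorPower ψ T)) =
      dotProduct (star (tensorPower ψ S)) (Matrix.mulVec B (tensorPower ψ S)) := by
  classical
  have h1 := star_tensorPower_dotProduct (T := {y : T // y ∉ Set.range ι}) ψ hψ
  simp only [dotProduct, Matrix.mulVec, Pi.star_apply] at h1 ⊢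
  rw [← Equiv.sum_comp (splitConfig hι).symm]
  have h2 : ∀ σ, ∑ x, tensorEmbed ι B ((splitConfig hι).symm σ) x * tensorPower ψ T x =
      (∑ ζ, B σ.1 ζ * tensorPower ψ S ζ) * tensorPower ψ {y : T // y ∉ Set.range ι} σ.2 := by
    intro σ
    rw [← Equiv.sum_comp (splitConfig hι).symm, Fintype.sum_prod_type, Finset.sum_mul]
    refine Finset.sum_congr rfl fun ζ _ => ?_
    simp only [tensorEmbed_eq_submatrix hι, Matrix.submatrix_apply, Equiv.apply_symm_apply,
      Matrix.kroneckerMap_apply, tensorPower_split, Matrix.one_apply]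
    rw [Finset.sum_eq_single σ.2]
    · rw [if_pos rfl]; ring
    · intro b _ hb
      rw [if_neg hb.symm]; ring
    · simp
  simp only [h2, tensorPower_split, star_mul']
  rw [Fintype.sum_prod_type]
  refine Finset.sum_congr rfl fun ζ _ => ?_
  calc _ = star (tensorPower ψ S ζ) * (∑ ζ', B ζ ζ' * tensorPower ψ S ζ') *
      ∑ ξ, star (tensorPower ψ {y : T // y ∉ Set.range ι} ξ) *
        tensorPower ψ {y : T // y ∉ Set.range ι} ξ := by
        rw [Finset.mul_sum]
        exact Finset.sum_congr rfl fun ξ _ => by ring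
    _ = _ := by rw [h1, mul_one]

end Embedding

/-! ### Projections onto ψ and factorization of expectation values. -/

section Projections

variable {d : ℕ} {T : Type} [Fintype T] [DecidableEq T] (ψ : Fin d → ℂ)

/-- The projection `|ψ⟩⟨ψ|` on each tensor factor in `S`. -/
def projOn (S : Finset T) : Matrix (T → Fin d) (T → Fin d) ℂ :=
  prodOp fun y => if y ∈ S then Matrix.vecMulVec ψ (star ψ) else 1

/-- The expectation value of `A` in the state `ψ^{⊗ T}`. -/
def expect (A : Matrix (T → Fin d) (T → Fin d) ℂ) : ℂ :=
  dotProduct (star (tensorPower ψ T)) (Matrix.mulVec A (tensorPower ψ T))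

theorem prodOp_one : prodOp (fun _ : T => (1 : Matrix (Fin d) (Fin d) ℂ)) = 1 := by
  ext σ σ'
  simp only [prodOp, Matrix.of_apply, Matrix.one_apply]
  by_cases h : σ = σ'
  · simp [h]
  · rw [if_neg h]
    obtain ⟨y, hy⟩ := Function.ne_iff.1 h
    exact Finset.prod_eq_zero (Finset.mem_univ y) (if_neg hy)

theorem projOn_empty : projOn ψ (∅ : Finset T) = 1 := by
  simp [projOn, prodOp_one]

theorem star_projOn (S : Finset T) : star (projOn ψ S) = projOn ψ S := by
  ext σ σ'
  simp only [Matrix.star_apply, projOn, prodOp, Matrix.of_apply, star_prod]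
  refine Finset.prod_congr rfl fun y _ => ?_
  split_ifs
  · simp [Matrix.vecMulVec_apply, mul_comm]
  · simp [Matrix.one_apply, eq_comm, apply_ite (starRingEnd ℂ)]

theorem projOn_univ :
    projOn ψ (Finset.univ : Finset T) =
      Matrix.vecMulVec (tensorPower ψ T) (star (tensorPower ψ T)) := by
  ext σ σ'
  simp [projOn, prodOp, Matrix.vecMulVec_apply, tensorPower, Finset.prod_mul_distrib]

variable {ψ}

theorem star_dotProduct_self (hψ : ∑ i, ‖ψ i‖ ^ 2 = 1) : dotProduct (star ψ) ψ = 1 := by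
  have : ∀ i, star (ψ i) * ψ i = ((‖ψ i‖ ^ 2 : ℝ) : ℂ) := fun i => by
    rw [Complex.star_def, Complex.conj_mul']; push_cast; rfl
  simp only [dotProduct, Pi.star_apply, this, ← Complex.ofReal_sum, hψ, Complex.ofReal_one]

theorem projOn_mul_projOn (hψ : ∑ i, ‖ψ i‖ ^ 2 = 1) (S S' : Finset T) :
    projOn ψ S * projOn ψ S' = projOn ψ (S ∪ S') := by
  have hP : Matrix.vecMulVec ψ (star ψ) * Matrix.vecMulVec ψ (star ψ) =
      Matrix.vecMulVec ψ (star ψ) := by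
    rw [Matrix.vecMulVec_mul_vecMulVec, star_dotProduct_self hψ, one_smul]
  rw [projOn, projOn, prodOp_mul, projOn]
  congr 1
  funext y
  by_cases h : y ∈ S <;> by_cases h' : y ∈ S' <;> simp [h, h', hP]

open scoped Matrix.Norms.L2Operator in
theorem norm_projOn_le (hψ : ∑ i, ‖ψ i‖ ^ 2 = 1) (S : Finset T) : ‖projOn ψ S‖ ≤ 1 := by
  have h := CStarRing.norm_star_mul_self (x := projOn ψ S)
  rw [star_projOn, projOn_mul_projOn hψ, Finset.union_self] at h
  nlinarith [norm_nonneg (projOn ψ S)]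

theorem commute_projOn (hψ : ∑ i, ‖ψ i‖ ^ 2 = 1) {A : Matrix (T → Fin d) (T → Fin d) ℂ}
    (S : Finset T) (h : ∀ y ∈ S, Commute A (projOn ψ {y})) : Commute A (projOn ψ S) := by
  induction S using Finset.induction_on with
  | empty => rw [projOn_empty]; exact Commute.one_right A
  | insert y S hy ih =>
    rw [Finset.insert_eq, ← projOn_mul_projOn hψ]
    exact (h y (by simp)).mul_right (ih fun z hz => h z (by simp [hz]))

/-- The full projection E = |Ψ⟩⟨Ψ| has rank one. This turns statements about expectation values into
operator identities, with |⟨A⟩| = ‖EAE‖. -/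
theorem projOn_univ_mul_mul (A : Matrix (T → Fin d) (T → Fin d) ℂ) :
    projOn ψ (Finset.univ : Finset T) * A * projOn ψ Finset.univ =
      expect ψ A • projOn ψ Finset.univ := by
  rw [projOn_univ, Matrix.vecMulVec_mul, Matrix.vecMulVec_mul_vecMulVec, expect,
    Matrix.dotProduct_mulVec, Matrix.vecMulVec_smul]

theorem projOn_univ_ne_zero (hψ : ∑ i, ‖ψ i‖ ^ 2 = 1) :
    projOn ψ (Finset.univ : Finset T) ≠ 0 := by
  intro h
  have h1 := star_tensorPower_dotProduct (T := T) ψ hψ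
  have h2 : Matrix.trace (projOn ψ (Finset.univ : Finset T)) = 1 := by
    rw [projOn_univ, Matrix.trace_vecMulVec, dotProduct_comm, h1]
  rw [h] at h2
  simp at h2

open scoped Matrix.Norms.L2Operator in
theorem norm_projOn_univ (hψ : ∑ i, ‖ψ i‖ ^ 2 = 1) : ‖projOn ψ (Finset.univ : Finset T)‖ = 1 := by
  have h := CStarRing.norm_star_mul_self (x := projOn ψ (Finset.univ : Finset T))
  rw [star_projOn, projOn_mul_projOn hψ, Finset.union_self] at h
  have h0 := norm_ne_zero_iff.2 (projOn_univ_ne_zero (T := T) hψ)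
  exact (mul_right_cancel₀ h0 ((one_mul _).trans h)).symm

open scoped Matrix.Norms.L2Operator in
theorem norm_expect_eq (hψ : ∑ i, ‖ψ i‖ ^ 2 = 1) (A : Matrix (T → Fin d) (T → Fin d) ℂ) :
    ‖expect ψ A‖ = ‖projOn ψ (Finset.univ : Finset T) * A * projOn ψ Finset.univ‖ := by
  rw [projOn_univ_mul_mul, norm_smul, norm_projOn_univ hψ, mul_one]

open scoped Matrix.Norms.L2Operator in
theorem norm_expect_le (hψ : ∑ i, ‖ψ i‖ ^ 2 = 1) (A : Matrix (T → Fin d) (T → Fin d) ℂ) :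
    ‖expect ψ A‖ ≤ ‖A‖ := by
  rw [norm_expect_eq hψ]
  calc _ ≤ ‖projOn ψ (Finset.univ : Finset T)‖ * ‖A‖ * ‖projOn ψ (Finset.univ : Finset T)‖ :=
        (norm_mul_le _ _).trans (mul_le_mul_of_nonneg_right (norm_mul_le _ _) (norm_nonneg _))
    _ = _ := by rw [norm_projOn_univ hψ, one_mul, mul_one]

theorem expect_sub (A B : Matrix (T → Fin d) (T → Fin d) ℂ) :
    expect ψ (A - B) = expect ψ A - expect ψ B := by
  simp [expect, Matrix.sub_mulVec]

theorem expect_one (hψ : ∑ i, ‖ψ i‖ ^ 2 = 1) :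
    expect ψ (1 : Matrix (T → Fin d) (T → Fin d) ℂ) = 1 := by
  simp [expect, star_tensorPower_dotProduct ψ hψ]

/-- Expectation values of products of operators on disjoint regions factorize. -/
theorem expect_mul (hψ : ∑ i, ‖ψ i‖ ^ 2 = 1) (S : Finset T)
    {A C : Matrix (T → Fin d) (T → Fin d) ℂ} (hA : ∀ y ∉ S, Commute A (projOn ψ {y}))
    (hC : ∀ y ∈ S, Commute C (projOn ψ {y})) :
    expect ψ (A * C) = expect ψ A * expect ψ C := by
  have h1 : Commute C (projOn ψ S) := commute_projOn hψ S hC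
  have h2 : Commute A (projOn ψ Sᶜ) := commute_projOn hψ _ fun y hy => hA y (by simpa using hy)
  set E := projOn ψ (Finset.univ : Finset T) with hE
  have e1 : E * projOn ψ Sᶜ = E := by rw [hE, projOn_mul_projOn hψ, Finset.union_eq_left.2 (Finset.subset_univ _)]
  have e2 : projOn ψ S * E = E := by rw [hE, projOn_mul_projOn hψ, Finset.union_eq_right.2 (Finset.subset_univ _)]
  have e3 : projOn ψ Sᶜ * projOn ψ S = E := by
    rw [hE, projOn_mul_projOn hψ, Finset.union_comm, Finset.union_compl]
  -- The outer factors E supply projections on Sᶜ and on S. These commute past A and C respectively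
  -- and meet in the middle, where their product is E and separates A from C.
  have key : E * (A * C) * E = (E * A * E) * C * E := by
    calc E * (A * C) * E = (E * projOn ψ Sᶜ) * (A * C) * (projOn ψ S * E) := by rw [e1, e2]
      _ = E * (projOn ψ Sᶜ * A) * (C * projOn ψ S) * E := by simp only [mul_assoc]
      _ = E * (A * projOn ψ Sᶜ) * (projOn ψ S * C) * E := by rw [h2.eq, h1.eq]
      _ = E * A * (projOn ψ Sᶜ * projOn ψ S) * C * E := by simp only [mul_assoc]
      _ = _ := by rw [e3]
  rw [hE, projOn_univ_mul_mul, projOn_univ_mul_mul, smul_mul_assoc, smul_mul_assoc,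
    projOn_univ_mul_mul, smul_smul] at key
  exact smul_left_injective ℂ (projOn_univ_ne_zero hψ) key

-- With Q = P_S, the inequality is |⟨Ψ, UΨ⟩|² ≤ ‖QUΨ‖², which holds because E = EQ.
open scoped Matrix.Norms.L2Operator in
theorem norm_expect_sq_le (hψ : ∑ i, ‖ψ i‖ ^ 2 = 1) (S : Finset T)
    (U : Matrix (T → Fin d) (T → Fin d) ℂ) :
    ‖expect ψ U‖ ^ 2 ≤ ‖expect ψ (star U * projOn ψ S * U)‖ := by
  obtain ⟨E, hE⟩ : ∃ E, E = projOn ψ (Finset.univ : Finset T) := ⟨_, rfl⟩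
  obtain ⟨Q, hQ⟩ : ∃ Q, Q = projOn ψ S := ⟨_, rfl⟩
  have e1 : E * Q = E := by
    rw [hE, hQ, projOn_mul_projOn hψ, Finset.union_eq_left.2 (Finset.subset_univ _)]
  have hQQ : Q * Q = Q := by rw [hQ, projOn_mul_projOn hψ, Finset.union_self]
  have hsE : star E = E := by rw [hE, star_projOn]
  have hsQ : star Q = Q := by rw [hQ, star_projOn]
  have hnE : ‖E‖ = 1 := by rw [hE, norm_projOn_univ hψ]
  rw [norm_expect_eq hψ, norm_expect_eq hψ, ← hE, ← hQ]
  have h1 : ‖E * U * E‖ ≤ ‖Q * U * E‖ := by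
    calc ‖E * U * E‖ = ‖E * (Q * U * E)‖ := by rw [← mul_assoc, ← mul_assoc, e1]
      _ ≤ ‖E‖ * ‖Q * U * E‖ := norm_mul_le _ _
      _ = _ := by rw [hnE, one_mul]
  have h2 : star (Q * U * E) * (Q * U * E) = E * (star U * Q * U) * E := by
    calc star (Q * U * E) * (Q * U * E) = E * (star U * (Q * Q) * U) * E := by
          simp only [star_mul, hsE, hsQ, mul_assoc]
      _ = _ := by rw [hQQ]
  have h3 := CStarRing.norm_star_mul_self (x := Q * U * E)
  rw [h2] at h3
  calc ‖E * U * E‖ ^ 2 ≤ ‖Q * U * E‖ * ‖Q * U * E‖ := by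
        rw [sq]; exact mul_self_le_mul_self (norm_nonneg _) h1
    _ = _ := h3.symm

open scoped ComplexOrder in
theorem expect_star_mul_self (hψ : ∑ i, ‖ψ i‖ ^ 2 = 1) (S : Finset T)
    (U : Matrix (T → Fin d) (T → Fin d) ℂ) :
    (‖expect ψ (star U * projOn ψ S * U)‖ : ℂ) = expect ψ (star U * projOn ψ S * U) := by
  have h : 0 ≤ expect ψ (star U * projOn ψ S * U) := by
    have e : star U * projOn ψ S * U = star (projOn ψ S * U) * (projOn ψ S * U) := by
      rw [star_mul, star_projOn, mul_assoc, mul_assoc, ← mul_assoc (projOn ψ S),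
        projOn_mul_projOn hψ, Finset.union_self]
    rw [e, expect]
    exact (Matrix.posSemidef_conjTranspose_mul_self _).dotProduct_mulVec_nonneg _
  exact (Complex.eq_coe_norm_of_nonneg h).symm

theorem tensorEmbed_unit (x : T) (B : Matrix (Fin d) (Fin d) ℂ) :
    tensorEmbed (fun _ : Unit => x) (Matrix.of fun a b => B (a ()) (b ())) =
      prodOp (fun y => if y = x then B else 1) := by
  ext σ σ'
  simp only [tensorEmbed, prodOp, Matrix.of_apply]
  rw [← Finset.mul_prod_erase Finset.univ _ (Finset.mem_univ x), if_pos rfl]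
  by_cases h : ∀ y, y ∉ Set.range (fun _ : Unit => x) → σ y = σ' y
  · rw [if_pos h, Finset.prod_eq_one, mul_one]
    intro y hy
    have hy' := Finset.ne_of_mem_erase hy
    rw [if_neg hy', h y (by rintro ⟨_, rfl⟩; exact hy' rfl), Matrix.one_apply_eq]
  · rw [if_neg h]
    push Not at h
    obtain ⟨y, hy, hne⟩ := h
    have hy' : y ≠ x := fun e => hy ⟨(), e.symm⟩
    rw [Finset.prod_eq_zero (Finset.mem_erase.2 ⟨hy', Finset.mem_univ y⟩), mul_zero]
    rw [if_neg hy', Matrix.one_apply_ne hne]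

theorem projOn_singleton (x : T) : projOn ψ {x} = tensorEmbed (fun _ : Unit => x)
    (Matrix.of fun a b => Matrix.vecMulVec ψ (star ψ) (a ()) (b ())) := by
  rw [tensorEmbed_unit, projOn]
  simp only [Finset.mem_singleton]

theorem commute_tensorEmbed_projOn {S : Type} (ι : S → T)
    (B : Matrix (S → Fin d) (S → Fin d) ℂ) {x : T} (hx : x ∉ Set.range ι) :
    Commute (tensorEmbed ι B) (projOn ψ {x}) := by
  rw [projOn_singleton]
  apply commute_tensorEmbed
  rw [Set.disjoint_left]
  rintro _ h ⟨_, rfl⟩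
  exact hx h

theorem tensorEmbed_projOn_singleton {S : Type} [Fintype S] [DecidableEq S] {ι : S → T}
    (hι : Function.Injective ι) (s : S) :
    tensorEmbed ι (projOn ψ {s}) = projOn ψ {ι s} := by
  rw [projOn_singleton, projOn_singleton, tensorEmbed_comp hι]
  rfl

end Projections

/-! ### The fidelity and the single-site overlap as expectation values. -/

section Lattice

variable {D d L : ℕ} [NeZero L] {ψ : Fin d → ℂ}

theorem productState_eq : productState ψ D L = tensorPower ψ (Site D L) := rfl

theorem braket_productState (A : Op D d L) :
    braket (productState ψ D L) A (productState ψ D L) = expect ψ A := rfl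

/-- The partial trace is dual to tensoring with the identity: both sides are ⟨ψ|ρ_x|ψ⟩. -/
theorem braket_onSite_reducedDensity (hψ : ∑ i, ‖ψ i‖ ^ 2 = 1) (x : Site D L) (R : Op D d L) :
    braket (productState ψ D L) (onSite x (reducedDensity x R)) (productState ψ D L) =
      Matrix.trace (R * projOn ψ {x}) := by
  have hι : Function.Injective (fun _ : Unit => x) := fun _ _ _ => rfl
  have e1 := expectation_tensorEmbed ψ hψ hι
    (Matrix.of fun a b => reducedDensity x R (a ()) (b ()))
  rw [braket, onSite, embed_eq_tensorEmbed, productState_eq, e1]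
  have e2 : ∀ f : (Unit → Fin d) → ℂ, ∑ a, f a = ∑ i, f fun _ => i := fun f =>
    Fintype.sum_equiv (Equiv.funUnique Unit (Fin d)) _ _ fun a => rfl
  simp only [dotProduct, Matrix.mulVec, e2, tensorPower, Matrix.of_apply, Pi.star_apply,
    Finset.univ_unique, Finset.prod_singleton, reducedDensity]
  simp only [Matrix.trace, Matrix.diag, Matrix.mul_apply]
  -- The projection at x connects σ only with configurations that agree with it off x, which are
  -- parametrized by their value b at x.
  have e3 : ∀ σ : Config D d L, (∑ σ', R σ σ' * projOn ψ {x} σ' σ)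
      = ∑ b, R σ (Function.update σ x b) * (ψ b * star (ψ (σ x))) := by
    intro σ
    simp only [projOn_singleton, tensorEmbed, Matrix.of_apply, Matrix.vecMulVec_apply,
      Pi.star_apply]
    symm
    refine Fintype.sum_of_injective (fun b => Function.update σ x b)
      (Function.update_injective σ x) _ _ ?_ ?_
    · intro σ' hσ'
      rw [if_neg, mul_zero]
      intro h
      refine hσ' ⟨σ' x, ?_⟩
      funext y
      by_cases hy : y = x
      · subst hy; simp
      · beta_reduce
        rw [Function.update_of_ne hy]
        exact (h y (by rintro ⟨_, rfl⟩; exact hy rfl)).symm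
    · intro b
      rw [if_pos, Function.update_self]
      intro y hy
      rw [Function.update_of_ne fun e => hy ⟨(), e.symm⟩]
  rw [Finset.sum_congr rfl fun σ _ => e3 σ]
  have e4 : ∀ a : Fin d, star (ψ a) * ∑ b, (∑ σ : Config D d L,
      if σ x = a then R σ (Function.update σ x b) else 0) * ψ b =
      ∑ σ : Config D d L, if σ x = a then
        ∑ b, R σ (Function.update σ x b) * (ψ b * star (ψ (σ x))) else 0 := by
    intro a
    simp only [Finset.sum_mul, Finset.mul_sum]
    rw [Finset.sum_comm]
    refine Finset.sum_congr rfl fun σ _ => ?_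
    split_ifs with h
    · subst h
      exact Finset.sum_congr rfl fun b _ => by ring
    · simp
  rw [Finset.sum_congr rfl fun a _ => e4 a, Finset.sum_comm]
  refine Finset.sum_congr rfl fun σ _ => ?_
  simp

theorem siteOverlap_eq_re (hψ : ∑ i, ‖ψ i‖ ^ 2 = 1) (H : Op D d L) (x : Site D L) (t : ℝ) :
    siteOverlap H (productState ψ D L) x t =
      (expect ψ (star (propagator H t) * projOn ψ {x} * propagator H t)).re := by
  rw [siteOverlap, braket_onSite_reducedDensity hψ, evolvedDensity]
  congr 1
  rw [mul_assoc, mul_assoc, Matrix.trace_mul_comm, mul_assoc, Matrix.vecMulVec_mul,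
    Matrix.trace_vecMulVec, dotProduct_comm, ← Matrix.dotProduct_mulVec]
  rfl

theorem siteOverlap_eq_norm (hψ : ∑ i, ‖ψ i‖ ^ 2 = 1) (H : Op D d L) (x : Site D L) (t : ℝ) :
    siteOverlap H (productState ψ D L) x t =
      ‖expect ψ (star (propagator H t) * projOn ψ {x} * propagator H t)‖ := by
  rw [siteOverlap_eq_re hψ, ← expect_star_mul_self hψ, Complex.ofReal_re]
  simp

open scoped Matrix.Norms.L2Operator in
theorem star_propagator_mul {H : Op D d L} (hH : H.IsHermitian) (t : ℝ) (A : Op D d L) :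
    star (propagator H t) * A * propagator H t = heis H t A := by
  rw [heis, propagator, ← star_exp_neg_smul (H := H) hH t]

open scoped Matrix.Norms.L2Operator in
theorem siteOverlap_eq (hψ : ∑ i, ‖ψ i‖ ^ 2 = 1) {H : Op D d L} (hH : H.IsHermitian)
    (x : Site D L) (t : ℝ) :
    siteOverlap H (productState ψ D L) x t = ‖expect ψ (heis H t (projOn ψ {x}))‖ := by
  rw [siteOverlap_eq_norm hψ, star_propagator_mul hH]

open scoped Matrix.Norms.L2Operator in
theorem ofReal_siteOverlap (hψ : ∑ i, ‖ψ i‖ ^ 2 = 1) {H : Op D d L} (hH : H.IsHermitian)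
    (x : Site D L) (t : ℝ) :
    (siteOverlap H (productState ψ D L) x t : ℂ) = expect ψ (heis H t (projOn ψ {x})) := by
  rw [siteOverlap_eq_norm hψ, expect_star_mul_self hψ, star_propagator_mul hH]

theorem siteOverlap_nonneg (hψ : ∑ i, ‖ψ i‖ ^ 2 = 1) (H : Op D d L)
    (x : Site D L) (t : ℝ) : 0 ≤ siteOverlap H (productState ψ D L) x t := by
  rw [siteOverlap_eq_norm hψ]; exact norm_nonneg _

open scoped Matrix.Norms.L2Operator in
theorem siteOverlap_le_one (hψ : ∑ i, ‖ψ i‖ ^ 2 = 1) {H : Op D d L} (hH : H.IsHermitian)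
    (x : Site D L) (t : ℝ) : siteOverlap H (productState ψ D L) x t ≤ 1 := by
  rw [siteOverlap_eq hψ hH]
  have h1 := norm_heis (𝒜 := Op D d L) hH t (projOn ψ {x})
  have h2 := norm_projOn_le hψ {x}
  have h3 := norm_expect_le hψ (heis (𝒜 := Op D d L) H t (projOn ψ {x}))
  rw [h1] at h3
  exact h3.trans h2

open scoped Matrix.Norms.L2Operator in
theorem fidelity_sq_le (hψ : ∑ i, ‖ψ i‖ ^ 2 = 1) {H : Op D d L} (hH : H.IsHermitian)
    (t : ℝ) (S : Finset (Site D L)) :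
    fidelity H (productState ψ D L) t ^ 2 ≤ ‖expect ψ (heis H t (projOn ψ S))‖ := by
  rw [fidelity, braket_productState, ← star_propagator_mul hH]
  exact norm_expect_sq_le hψ S _

theorem fidelity_sq_le_siteOverlap (hψ : ∑ i, ‖ψ i‖ ^ 2 = 1) {H : Op D d L} (hH : H.IsHermitian)
    (x : Site D L) (t : ℝ) :
    fidelity H (productState ψ D L) t ^ 2 ≤ siteOverlap H (productState ψ D L) x t := by
  rw [siteOverlap_eq hψ hH]
  exact fidelity_sq_le hψ hH t {x}

end Lattice

/-! ### Distance and balls on the torus. -/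

section Geometry

variable {D L : ℕ} [NeZero L]

/-- The distance from the origin in the maximum norm on the torus `ℤ_L^D`. -/
def torusNorm (v : Site D L) : ℕ := Finset.univ.sup fun i => (v i).valMinAbs.natAbs

theorem torusNorm_le_iff {v : Site D L} {m : ℕ} :
    torusNorm v ≤ m ↔ ∀ i, (v i).valMinAbs.natAbs ≤ m := by
  simp [torusNorm, Finset.sup_le_iff]

theorem natAbs_valMinAbs_intCast_le (z : ℤ) : (z : ZMod L).valMinAbs.natAbs ≤ z.natAbs :=
  ZMod.natAbs_min_of_le_div_two L _ _ (by simp) (ZMod.natAbs_valMinAbs_le _)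

/-- The least absolute residues `valMinAbs` are the shortest integer displacements, so the given
balls are those of a translation-invariant metric and the triangle inequality becomes available. -/
theorem mem_ball_iff {x y : Site D L} {r : ℕ} : y ∈ ball x r ↔ torusNorm (y - x) ≤ r := by
  rw [torusNorm_le_iff]
  constructor
  · rintro ⟨z, hz, h⟩ i
    rw [Pi.sub_apply, h i, add_sub_cancel_left]
    have := natAbs_valMinAbs_intCast_le (L := L) (z i)
    have := hz i
    rw [Int.abs_eq_natAbs] at this
    omega
  · intro h
    refine ⟨fun i => ((y - x) i).valMinAbs, fun i => ?_, fun i => ?_⟩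
    · have := h i
      beta_reduce
      rw [Int.abs_eq_natAbs]
      omega
    · simp

theorem torusNorm_zero : torusNorm (0 : Site D L) = 0 := by
  have : torusNorm (0 : Site D L) ≤ 0 := torusNorm_le_iff.2 fun i => by simp
  omega

theorem torusNorm_neg (v : Site D L) : torusNorm (-v) = torusNorm v := by
  simp [torusNorm]

theorem torusNorm_sub_comm (v w : Site D L) : torusNorm (v - w) = torusNorm (w - v) := by
  rw [← torusNorm_neg, neg_sub]

theorem torusNorm_add_le (v w : Site D L) : torusNorm (v + w) ≤ torusNorm v + torusNorm w := by
  rw [torusNorm_le_iff]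
  intro i
  have h1 := torusNorm_le_iff.1 (le_refl (torusNorm v)) i
  have h2 := torusNorm_le_iff.1 (le_refl (torusNorm w)) i
  have h3 := ZMod.natAbs_valMinAbs_add_le (v i) (w i)
  rw [Pi.add_apply]
  omega

theorem torusNorm_sub_le (x y z : Site D L) :
    torusNorm (x - z) ≤ torusNorm (x - y) + torusNorm (y - z) := by
  rw [← sub_add_sub_cancel x y z]
  exact torusNorm_add_le _ _

/-- The sites at distance at most `m` from `x`. -/
def ballFinset (x : Site D L) (m : ℕ) : Finset (Site D L) :=
  Finset.univ.filter fun y => torusNorm (y - x) ≤ m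

theorem mem_ballFinset {x y : Site D L} {m : ℕ} :
    y ∈ ballFinset x m ↔ torusNorm (y - x) ≤ m := by
  simp [ballFinset]

theorem card_ballFinset_le (x : Site D L) (m : ℕ) : (ballFinset x m).card ≤ (2 * m + 1) ^ D := by
  have hsub : ballFinset x m ⊆ (Fintype.piFinset fun _ : Fin D => Finset.Icc (-(m : ℤ)) m).image
      fun z i => x i + (z i : ZMod L) := by
    intro y hy
    rw [mem_ballFinset, ← mem_ball_iff] at hy
    obtain ⟨z, hz, h⟩ := hy
    refine Finset.mem_image.2 ⟨z, ?_, ?_⟩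
    · rw [Fintype.mem_piFinset]
      intro i
      exact Finset.mem_Icc.2 (abs_le.1 (hz i))
    · funext i
      exact (h i).symm
  refine (Finset.card_le_card hsub).trans (Finset.card_image_le.trans ?_)
  rw [Fintype.card_piFinset]
  simp only [Int.card_Icc, Finset.prod_const, Finset.card_univ, Fintype.card_fin]
  apply le_of_eq
  congr 1
  omega

end Geometry

/-! ### Quasi-locality of the evolved projections. -/

section LocalDynamics

open scoped Matrix.Norms.L2Operator

variable {D d L : ℕ} [NeZero L] {ψ : Fin d → ℂ} {r : ℕ} {J : ℝ} {h : Site D L → Op D d L}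

theorem IsLocalHamiltonian.isHermitian (hh : IsLocalHamiltonian r J h) :
    (hamiltonian h).IsHermitian := by
  have : IsSelfAdjoint (hamiltonian h) := isSelfAdjoint_sum _ fun i _ => hh.hermitian i
  exact this

theorem IsLocalHamiltonian.commute (hh : IsLocalHamiltonian r J h) {y z : Site D L}
    (hyz : 2 * r < torusNorm (y - z)) : Commute (h y) (h z) := by
  obtain ⟨B, hB⟩ := hh.strictly_local y
  obtain ⟨C, hC⟩ := hh.strictly_local z
  rw [hB, hC, embed_eq_tensorEmbed, embed_eq_tensorEmbed]
  apply commute_tensorEmbed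
  rw [Subtype.range_val, Subtype.range_val, Set.disjoint_left]
  intro u hu hu'
  rw [mem_ball_iff] at hu hu'
  have := torusNorm_sub_le y u z
  rw [torusNorm_sub_comm y u] at this
  omega

theorem IsLocalHamiltonian.commute_projOn (hh : IsLocalHamiltonian r J h) {y z : Site D L}
    (hyz : r < torusNorm (y - z)) : Commute (h z) (projOn ψ {y}) := by
  obtain ⟨C, hC⟩ := hh.strictly_local z
  rw [hC, embed_eq_tensorEmbed]
  apply commute_tensorEmbed_projOn
  rw [Subtype.range_val, mem_ball_iff]
  omega

/-- The evolution at time `t` of the projection at `x`, generated by the terms whose support is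
within distance `R` of `x`. -/
def localEvolution (ψ : Fin d → ℂ) (h : Site D L → Op D d L) (r R : ℕ) (t : ℝ) (x : Site D L) :
    Op D d L :=
  heis (∑ z ∈ Finset.univ.filter (fun z => torusNorm (z - x) + r ≤ R), h z) t (projOn ψ {x})

/-- The constant in the Lieb–Robinson estimate. -/
def lrConst (D r : ℕ) (J t : ℝ) : ℝ :=
  t * (2 * J * Real.exp (4 * r) *
    Real.exp (2 * J * ((2 * (2 * r) + 1) ^ D : ℕ) * (1 + Real.exp (4 * r)) * t))

theorem IsLocalHamiltonian.nonneg (hh : IsLocalHamiltonian r J h) : 0 ≤ J := by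
  exact (norm_nonneg _).trans (hh.bounded 0)

/-- Lieb–Robinson with weight e^{2 dist(z, x)}. Noncommuting terms are at distance at most 2r, which
gives the ratio Γ = e^{4r} and the neighbour count (4r + 1)^D. Initially only terms within r of x
fail to commute with P_x, and the discarded terms have weight at least e^{2R − 2r}; hence the factor
e^{4r} e^{-2R}. The factor L^D counts the discarded terms crudely. -/
theorem IsLocalHamiltonian.norm_heis_sub_localEvolution_le (hh : IsLocalHamiltonian r J h)
    (hψ : ∑ i, ‖ψ i‖ ^ 2 = 1) {t : ℝ} (ht : 0 ≤ t) (R : ℕ) (x : Site D L) :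
    ‖heis (hamiltonian h) t (projOn ψ {x}) - localEvolution ψ h r R t x‖ ≤
      lrConst D r J t * ((L : ℝ) ^ D * Real.exp (-(2 * R))) := by
  have hJ0 := hh.nonneg
  have hΓ : ∀ z : Site D L, ∀ y ∈ ballFinset z (2 * r), Real.exp (2 * torusNorm (z - x)) ≤
      Real.exp (4 * r) * Real.exp (2 * torusNorm (y - x)) := by
    intro z y hy
    rw [← Real.exp_add]
    apply Real.exp_le_exp.2
    rw [mem_ballFinset] at hy
    have h1 := torusNorm_sub_le z y x
    rw [torusNorm_sub_comm z y] at h1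
    have h2 : torusNorm (z - x) ≤ 2 * r + torusNorm (y - x) := by omega
    have h3 : (torusNorm (z - x) : ℝ) ≤ 2 * r + torusNorm (y - x) := by exact_mod_cast h2
    linarith
  have hM : ∀ z, Real.exp (2 * torusNorm (z - x)) *
      ‖h z * projOn ψ {x} - projOn ψ {x} * h z‖ ≤ 2 * J * Real.exp (2 * r) := by
    intro z
    by_cases hz : torusNorm (x - z) ≤ r
    · have h1 := norm_commutator_le (𝒜 := Op D d L) (hh.bounded z) (norm_projOn_le hψ {x})
      have h2 : Real.exp (2 * torusNorm (z - x)) ≤ Real.exp (2 * r) := by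
        apply Real.exp_le_exp.2
        rw [torusNorm_sub_comm]
        have : (torusNorm (x - z) : ℝ) ≤ r := by exact_mod_cast hz
        linarith
      rw [mul_comm]
      exact mul_le_mul h1 h2 (Real.exp_pos _).le (by positivity)
    · have h1 := hh.commute_projOn (ψ := ψ) (not_le.1 hz)
      rw [sub_eq_zero.2 h1.eq, norm_zero, mul_zero]
      positivity
  have hW : ∀ z, z ∉ Finset.univ.filter (fun z => torusNorm (z - x) + r ≤ R) →
      Real.exp (2 * R - 2 * r) ≤ Real.exp (2 * torusNorm (z - x)) := by
    intro z hz
    have hz' : ¬ (torusNorm (z - x) + r ≤ R) := by simpa using hz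
    apply Real.exp_le_exp.2
    have h2 : R ≤ torusNorm (z - x) + r := by omega
    have h3 : (R : ℝ) ≤ torusNorm (z - x) + r := by exact_mod_cast h2
    linarith
  have hnb : ∀ z y, y ∉ ballFinset z (2 * r) → Commute (h y) (h z) :=
    fun z y hy => hh.commute (by simpa [mem_ballFinset] using hy)
  have hM0 : 0 ≤ 2 * J * Real.exp (2 * r) := by positivity
  have key := norm_heis_sub_heis_sum_le (𝒜 := Op D d L) h (fun z => ballFinset z (2 * r))
    (fun z => Real.exp (2 * torusNorm (z - x)))
    (projOn ψ {x}) (Finset.univ.filter (fun z => torusNorm (z - x) + r ≤ R))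
    hh.hermitian hh.bounded hJ0 hnb
    (fun z => card_ballFinset_le z _) (fun z => Real.exp_pos _) hΓ (Real.exp_pos _).le hM
    hM0 hW (Real.exp_pos _) ht
  refine key.trans (le_of_eq ?_)
  rw [Fintype.card_pi_const, ZMod.card, lrConst, div_eq_mul_inv, ← Real.exp_neg]
  have : Real.exp (4 * (r : ℝ)) * Real.exp (-(2 * R)) =
      Real.exp (2 * r) * Real.exp (-(2 * R - 2 * r)) := by
    rw [← Real.exp_add, ← Real.exp_add]; congr 1; ring
  push_cast
  linear_combination (-(t * L ^ D * 2 * J *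
    Real.exp (2 * J * (2 * (2 * r) + 1) ^ D * (1 + Real.exp (4 * r)) * t))) * this

/-- Every retained term is supported within R of x. Commutation with the single-site projections
outside the ball is the only form of locality that `expect_mul` needs. -/
theorem IsLocalHamiltonian.commute_localEvolution (hh : IsLocalHamiltonian r J h) (R : ℕ) (t : ℝ)
    {x y : Site D L} (hy : R < torusNorm (y - x)) :
    Commute (localEvolution ψ h r R t x) (projOn ψ {y}) := by
  apply Commute.symm
  apply Commute.heis
  · apply Commute.sum_right
    intro z hz
    apply Commute.symm
    apply hh.commute_projOn
    have hz' : torusNorm (z - x) + r ≤ R := by simpa using hz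
    have := torusNorm_sub_le y z x
    omega
  · have hne : y ≠ x := by
      rintro rfl
      rw [sub_self, torusNorm_zero] at hy
      omega
    rw [projOn_singleton x]
    exact (commute_tensorEmbed_projOn _ _ (by rintro ⟨_, h⟩; exact hne h.symm)).symm

theorem IsLocalHamiltonian.norm_localEvolution_le (hh : IsLocalHamiltonian r J h)
    (hψ : ∑ i, ‖ψ i‖ ^ 2 = 1) (R : ℕ) (t : ℝ) (x : Site D L) :
    ‖localEvolution ψ h r R t x‖ ≤ 1 := by
  have hs : IsSelfAdjoint (∑ z ∈ Finset.univ.filter (fun z => torusNorm (z - x) + r ≤ R), h z) :=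
    isSelfAdjoint_sum _ fun i _ => hh.hermitian i
  have h1 := norm_heis (𝒜 := Op D d L) hs t (projOn ψ {x})
  rw [localEvolution, h1]
  exact norm_projOn_le hψ _

end LocalDynamics

/-! ### Translation invariance of the single-site overlap. -/

section Translations

open scoped Matrix.Norms.L2Operator

variable {D d L : ℕ} [NeZero L] {ψ : Fin d → ℂ} {H : Op D d L}

/-- The action of a lattice translation on configurations. -/
def shiftConfig (D d L : ℕ) (a : Site D L) : Config D d L ≃ Config D d L where
  toFun σ := fun x => σ (x + a)
  invFun σ := fun x => σ (x - a)
  left_inv σ := by funext x; simp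
  right_inv σ := by funext x; simp

theorem tensorPower_shiftConfig (a : Site D L) (σ : Config D d L) :
    tensorPower ψ (Site D L) (shiftConfig D d L a σ) = tensorPower ψ (Site D L) σ :=
  Equiv.prod_comp (Equiv.addRight a) fun y => ψ (σ y)

theorem expect_submatrix_shiftConfig (a : Site D L) (A : Op D d L) :
    expect ψ (A.submatrix (shiftConfig D d L a) (shiftConfig D d L a)) = expect ψ A := by
  simp only [expect, dotProduct, Matrix.mulVec, Pi.star_apply, Matrix.submatrix_apply]
  have h1 : ∀ τ, ∑ σ', A τ (shiftConfig D d L a σ') * tensorPower ψ (Site D L) σ' =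
      ∑ σ', A τ σ' * tensorPower ψ (Site D L) σ' := fun τ => by
    rw [← Equiv.sum_comp (shiftConfig D d L a) (fun σ' => A τ σ' * tensorPower ψ (Site D L) σ')]
    simp only [tensorPower_shiftConfig]
  simp only [h1]
  rw [← Equiv.sum_comp (shiftConfig D d L a)
    (fun σ => star (tensorPower ψ (Site D L) σ) * ∑ σ', A σ σ' * tensorPower ψ (Site D L) σ')]
  simp only [tensorPower_shiftConfig]

theorem projOn_submatrix_shiftConfig (a x : Site D L) :
    (projOn ψ {x}).submatrix (shiftConfig D d L a) (shiftConfig D d L a) = projOn ψ {x + a} := by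
  ext σ σ'
  simp only [Matrix.submatrix_apply, projOn, prodOp, Matrix.of_apply]
  refine Eq.trans ?_ (Equiv.prod_comp (Equiv.addRight a) fun y =>
    (if y ∈ ({x + a} : Finset (Site D L)) then Matrix.vecMulVec ψ (star ψ) else 1) (σ y) (σ' y))
  refine Finset.prod_congr rfl fun y _ => ?_
  have e : y + a ∈ ({x + a} : Finset (Site D L)) ↔ y ∈ ({x} : Finset (Site D L)) := by simp
  change _ = (if y + a ∈ ({x + a} : Finset (Site D L)) then Matrix.vecMulVec ψ (star ψ) else 1)
    (σ (y + a)) (σ' (y + a))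
  rw [if_congr e rfl rfl]
  rfl

/-- Relabelling configurations by a translation is an algebra automorphism that fixes H, carries P_x
to P_{x+a}, and preserves expectations in Ψ. -/
theorem expect_heis_add (hH : TranslationInvariant H) (t : ℝ) (a x : Site D L) :
    expect ψ (heis H t (projOn ψ {x + a})) = expect ψ (heis H t (projOn ψ {x})) := by
  have key := map_heis (𝒜 := Op D d L) (ℬ := Op D d L)
    (Matrix.reindexAlgEquiv ℂ ℂ (shiftConfig D d L a).symm).toAlgHom
    (LinearMap.continuous_of_finiteDimensional
      (Matrix.reindexAlgEquiv ℂ ℂ (shiftConfig D d L a).symm).toAlgHom.toLinearMap)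
    H (projOn ψ {x}) t
  have e : ∀ A : Op D d L, (Matrix.reindexAlgEquiv ℂ ℂ (shiftConfig D d L a).symm).toAlgHom A =
      A.submatrix (shiftConfig D d L a) (shiftConfig D d L a) := fun A => rfl
  rw [e, e, e, projOn_submatrix_shiftConfig] at key
  have hH' : H.submatrix (shiftConfig D d L a) (shiftConfig D d L a) = H := by
    ext σ σ'
    exact hH a σ σ'
  rw [hH'] at key
  rw [← key, expect_submatrix_shiftConfig]

theorem siteOverlap_eq_of_translationInvariant (hψ : ∑ i, ‖ψ i‖ ^ 2 = 1) (hH : H.IsHermitian)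
    (hT : TranslationInvariant H) (t : ℝ) (x y : Site D L) :
    siteOverlap H (productState ψ D L) x t = siteOverlap H (productState ψ D L) y t := by
  rw [siteOverlap_eq hψ hH, siteOverlap_eq hψ hH]
  have := expect_heis_add (ψ := ψ) hT t (x - y) y
  rw [add_sub_cancel] at this
  rw [this]

end Translations

/-! ### Factorization over a sparse sublattice. -/

section Clustering

open scoped Matrix.Norms.L2Operator

variable {D d L : ℕ} [NeZero L] {ψ : Fin d → ℂ} {r : ℕ} {J : ℝ} {h : Site D L → Op D d L}

/-- The sites of a sublattice with spacing `ℓ` are pairwise further apart than `2 R`. -/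
theorem exists_separated_sites {R ℓ m : ℕ} (hR : 2 * R + 1 ≤ ℓ) (hm : ℓ * m ≤ L) :
    ∃ T : Finset (Site D L), T.card = m ^ D ∧
      ∀ x ∈ T, ∀ y ∈ T, x ≠ y → 2 * R < torusNorm (x - y) := by
  classical
  set f : (Fin D → Fin m) → Site D L := fun a i => ((ℓ * (a i : ℕ) : ℕ) : ZMod L) with hf
  have hsep : ∀ a b, a ≠ b → ℓ ≤ torusNorm (f a - f b) := by
    intro a b hab
    obtain ⟨i, hi⟩ := Function.ne_iff.1 hab
    have hle := torusNorm_le_iff.1 (le_refl (torusNorm (f a - f b))) i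
    refine le_trans ?_ hle
    set v := ((f a - f b) i).valMinAbs with hv
    have hcast : ((v : ℤ) : ZMod L) = ((ℓ * ((a i : ℕ) : ℤ) - ℓ * ((b i : ℕ) : ℤ) : ℤ) : ZMod L) := by
      rw [hv, ZMod.coe_valMinAbs]
      simp [hf]
    rw [ZMod.intCast_eq_intCast_iff_dvd_sub] at hcast
    obtain ⟨k, hk⟩ := hcast
    have ha := (a i).2
    have hb := (b i).2
    have hne : ((a i : ℕ) : ℤ) - ((b i : ℕ) : ℤ) ≠ 0 := by
      intro h0
      apply hi
      ext
      omega
    set u : ℤ := ((a i : ℕ) : ℤ) - ((b i : ℕ) : ℤ) with hu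
    have hu1 : |u| ≤ m - 1 := by rw [abs_le]; constructor <;> omega
    have hu0 : 1 ≤ |u| := Int.one_le_abs hne
    have hveq : v = ℓ * u - L * k := by rw [hu]; linarith
    have hL : (ℓ : ℤ) * m ≤ L := by exact_mod_cast hm
    have hℓ : (0 : ℤ) ≤ ℓ := by positivity
    -- The coordinate difference is ℓu − Lk with 1 ≤ |u| ≤ m − 1. For k = 0 its modulus is at least
    -- ℓ; for k ≠ 0 it is at least L − ℓ(m − 1) ≥ ℓ, because ℓm ≤ L.
    have goal : (ℓ : ℤ) ≤ |v| := by
      by_cases hk0 : k = 0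
      · rw [hveq, hk0, mul_zero, sub_zero, abs_mul, abs_of_nonneg hℓ]
        nlinarith
      · have hk1 : 1 ≤ |k| := Int.one_le_abs hk0
        have h1 : |(L : ℤ) * k| - |(ℓ : ℤ) * u| ≤ |v| := by
          rw [hveq, abs_sub_comm]
          exact abs_sub_abs_le_abs_sub _ _
        rw [abs_mul, abs_mul, abs_of_nonneg hℓ, abs_of_nonneg (by positivity : (0 : ℤ) ≤ L)] at h1
        nlinarith
    rw [Int.abs_eq_natAbs] at goal
    exact_mod_cast goal
  have hinj : Function.Injective f := by
    intro a b hab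
    by_contra hne
    have := hsep a b hne
    rw [hab, sub_self, torusNorm_zero] at this
    omega
  refine ⟨Finset.univ.image f, ?_, ?_⟩
  · rw [Finset.card_image_of_injective _ hinj]
    simp
  · intro x hx y hy hxy
    obtain ⟨a, -, rfl⟩ := Finset.mem_image.1 hx
    obtain ⟨b, -, rfl⟩ := Finset.mem_image.1 hy
    have := hsep a b fun e => hxy (by rw [e])
    omega

/-- C is the product of the localized evolutions over T, built one site at a time. The commutation
clause records where C is supported; it lets `expect_mul` split off the next factor, whose ball is
disjoint from the earlier ones. -/
theorem IsLocalHamiltonian.exists_approx_projOn (hh : IsLocalHamiltonian r J h)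
    (hψ : ∑ i, ‖ψ i‖ ^ 2 = 1) {t p ε : ℝ} {R : ℕ} (hp0 : 0 ≤ p) (hp1 : p ≤ 1)
    (hp : ∀ x, ‖expect ψ (heis (hamiltonian h) t (projOn ψ {x}))‖ ≤ p)
    (hε : ∀ x, ‖heis (hamiltonian h) t (projOn ψ {x}) - localEvolution ψ h r R t x‖ ≤ ε)
    (T : Finset (Site D L)) (hT : ∀ x ∈ T, ∀ y ∈ T, x ≠ y → 2 * R < torusNorm (x - y)) :
    ∃ C : Op D d L, ‖heis (hamiltonian h) t (projOn ψ T) - C‖ ≤ T.card * ε ∧ ‖C‖ ≤ 1 ∧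
      (∀ y, (∀ x ∈ T, R < torusNorm (y - x)) → Commute C (projOn ψ {y})) ∧
      ‖expect ψ C‖ ≤ p ^ T.card + T.card * ε := by
  have hε0 : 0 ≤ ε := (norm_nonneg _).trans (hε 0)
  induction T using Finset.induction_on with
  | empty =>
    refine ⟨1, ?_, ?_, fun y _ => Commute.one_left _, ?_⟩
    · rw [projOn_empty]
      have := heis_one (hamiltonian h) t
      rw [this, sub_self, norm_zero]
      simp
    · have := norm_projOn_le (T := Site D L) hψ ∅
      rwa [projOn_empty] at this
    · rw [expect_one hψ]; simp
  | insert x T hx ih =>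
    obtain ⟨C, hC1, hC2, hC3, hC4⟩ := ih fun y hy z hz => hT y (by simp [hy]) z (by simp [hz])
    obtain ⟨A, hA⟩ : ∃ A, A = localEvolution ψ h r R t x := ⟨_, rfl⟩
    have hA1 : ‖heis (hamiltonian h) t (projOn ψ {x}) - A‖ ≤ ε := by rw [hA]; exact hε x
    have hA2 : ‖A‖ ≤ 1 := by rw [hA]; exact hh.norm_localEvolution_le hψ R t x
    have hA3 : ∀ y, R < torusNorm (y - x) → Commute A (projOn ψ {y}) := by
      rw [hA]; exact fun y hy => hh.commute_localEvolution R t hy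
    have hA4 : ‖expect ψ A‖ ≤ p + ε := by
      have h1 := norm_expect_le hψ (heis (hamiltonian h) t (projOn ψ {x}) - A)
      rw [expect_sub] at h1
      have h2 := norm_sub_norm_le (expect ψ A) (expect ψ (heis (hamiltonian h) t (projOn ψ {x})))
      rw [norm_sub_rev] at h2
      have h3 := hp x
      linarith
    have hA5 : ‖expect ψ A‖ ≤ 1 := (norm_expect_le hψ A).trans hA2
    have hcard : (insert x T).card = T.card + 1 := Finset.card_insert_of_notMem hx
    refine ⟨A * C, ?_, norm_mul_le_one hA2 hC2, ?_, ?_⟩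
    · have ha : ‖heis (hamiltonian h) t (projOn ψ {x})‖ ≤ 1 := by
        have := norm_heis (𝒜 := Op D d L) hh.isHermitian t (projOn ψ {x})
        rw [this]
        exact norm_projOn_le hψ _
      have key := norm_mul_sub_mul_le_of_norm_le_one ha hC2 hC1 hA1
      have e := heis_mul (hamiltonian h) t (projOn ψ {x}) (projOn ψ T)
      rw [projOn_mul_projOn hψ, ← Finset.insert_eq] at e
      rw [e, hcard]
      refine key.trans (le_of_eq ?_)
      push_cast
      ring
    · intro y hy
      exact (hA3 y (hy x (by simp))).mul_left (hC3 y fun z hz => hy z (by simp [hz]))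
    · have e := expect_mul hψ (ballFinset x R) (A := A) (C := C)
        (fun y hy => hA3 y (by simpa [mem_ballFinset] using hy))
        (fun y hy => hC3 y fun z hz => by
          rw [mem_ballFinset] at hy
          have h1 := hT x (by simp) z (by simp [hz]) (by rintro rfl; exact hx hz)
          have h2 := torusNorm_sub_le x y z
          rw [torusNorm_sub_comm x y] at h2
          omega)
      rw [e, norm_mul, hcard]
      have hpn : p ^ T.card ≤ 1 := pow_le_one₀ hp0 hp1
      have hpn0 : 0 ≤ p ^ T.card := pow_nonneg hp0 _
      have hn := norm_nonneg (expect ψ A)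
      have hTε : 0 ≤ (T.card : ℝ) * ε := by positivity
      -- The expectation of A is bounded by p + ε in the main term but by 1 in the error term, so
      -- that errors add up instead of multiplying.
      calc _ ≤ ‖expect ψ A‖ * (p ^ T.card + T.card * ε) := mul_le_mul_of_nonneg_left hC4 hn
        _ = ‖expect ψ A‖ * p ^ T.card + ‖expect ψ A‖ * (T.card * ε) := by ring
        _ ≤ (p + ε) * p ^ T.card + 1 * (T.card * ε) := by gcongr
        _ = p * p ^ T.card + ε * p ^ T.card + T.card * ε := by ring
        _ ≤ p * p ^ T.card + ε * 1 + T.card * ε := by gcongr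
        _ = _ := by push_cast; ring

/-- The fidelity is bounded by a power of the single-site overlap, up to a Lieb–Robinson error. -/
theorem IsLocalHamiltonian.fidelity_sq_le (hh : IsLocalHamiltonian r J h)
    (hψ : ∑ i, ‖ψ i‖ ^ 2 = 1) {t : ℝ} (ht : 0 ≤ t) (x : Site D L) {R ℓ m : ℕ}
    (hR : 2 * R + 1 ≤ ℓ) (hm : ℓ * m ≤ L) :
    fidelity (hamiltonian h) (productState ψ D L) t ^ 2 ≤
      siteOverlap (hamiltonian h) (productState ψ D L) x t ^ (m ^ D) +
        2 * (m : ℝ) ^ D * (lrConst D r J t * ((L : ℝ) ^ D * Real.exp (-(2 * R)))) := by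
  obtain ⟨T, hT1, hT2⟩ := exists_separated_sites (D := D) hR hm
  obtain ⟨C, hC1, -, -, hC4⟩ := hh.exists_approx_projOn hψ
    (siteOverlap_nonneg hψ (hamiltonian h) x t) (siteOverlap_le_one hψ hh.isHermitian x t)
    (fun y => by
      rw [← siteOverlap_eq hψ hh.isHermitian, siteOverlap_eq_of_translationInvariant hψ
        hh.isHermitian hh.invariant t y x])
    (fun y => hh.norm_heis_sub_localEvolution_le hψ ht R y) T hT2
  -- The error m^D ε enters twice: in replacing the evolved projection by C, and in the bound on the
  -- expectation of C.
  have h1 := SpinLattice.fidelity_sq_le hψ hh.isHermitian t T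
  have h2 := norm_expect_le hψ (heis (hamiltonian h) t (projOn ψ T) - C)
  rw [expect_sub] at h2
  have h3 := norm_sub_norm_le (expect ψ (heis (hamiltonian h) t (projOn ψ T))) (expect ψ C)
  rw [hT1] at hC1 hC4
  push_cast at hC1 hC4
  linarith

end Clustering

/-- By the identity theorem the zeros form a discrete set, and a discrete subset of the line is
countable because it is Lindelöf. -/
theorem countable_zeros_of_analytic {f : ℝ → ℂ} (hf : AnalyticOnNhd ℝ f Set.univ) {x : ℝ}
    (hx : f x ≠ 0) : {t | f t = 0}.Countable := by
  have h := hf.preimage_zero_mem_codiscrete hx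
  have hd : IsDiscrete {t | f t = 0} := by
    rw [← Set.inter_univ {t | f t = 0}]
    exact isDiscrete_of_codiscreteWithin h
  have := hd.to_subtype
  exact Set.countable_coe_iff.1 (countable_of_Lindelof_of_discrete (X := {t | f t = 0}))

/-! ### The rate in terms of the overlap. -/

section Rate

variable {D d L : ℕ} [NeZero L] {H : Op D d L} {Ψ : StateVec D d L} {x : Site D L} {t : ℝ}

theorem rate_eq_top (h : siteOverlap H Ψ x t ≤ 0) : rate H Ψ x t = ⊤ := by
  rw [rate, ENNReal.ofReal_of_nonpos h]
  simp

theorem rate_eq_ofReal (h : 0 < siteOverlap H Ψ x t) :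
    rate H Ψ x t = ENNReal.ofReal (-Real.log (siteOverlap H Ψ x t)) := by
  rw [rate, ENNReal.log_ofReal_of_pos h, ← EReal.coe_neg, EReal.toENNReal_of_ne_top (by simp)]
  rfl

theorem rate_pos_iff (h0 : 0 ≤ siteOverlap H Ψ x t) :
    0 < rate H Ψ x t ↔ siteOverlap H Ψ x t < 1 := by
  rcases h0.eq_or_lt with h | h
  · rw [rate_eq_top h.symm.le, ← h]; simp
  · rw [rate_eq_ofReal h, ENNReal.ofReal_pos, Left.neg_pos_iff, Real.log_neg_iff h]

end Rate

/-! ### Times at which the rate vanishes. -/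

section Revival

open scoped Matrix.Norms.L2Operator

variable {D d L : ℕ} [NeZero L] {ψ : Fin d → ℂ} {H : Op D d L}

/-- The component of `A Ψ` orthogonal to `Ψ = ψ^{⊗ N}`, in the product basis. -/
def orthPart (ψ : Fin d → ℂ) (A : Op D d L) (σ : Config D d L) : ℂ :=
  Matrix.mulVec A (tensorPower ψ (Site D L)) σ - expect ψ A * tensorPower ψ (Site D L) σ

/-- `orthPart` as a linear functional of the operator. -/
def orthPartLinear (ψ : Fin d → ℂ) (σ : Config D d L) : Op D d L →ₗ[ℂ] ℂ where
  toFun A := orthPart ψ A σ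
  map_add' A B := by
    simp only [orthPart, expect, Matrix.add_mulVec, dotProduct_add, Pi.add_apply]
    ring
  map_smul' c A := by
    simp only [orthPart, expect, Matrix.smul_mulVec, dotProduct_smul, Pi.smul_apply, smul_eq_mul,
      RingHom.id_apply]
    ring

-- ‖(1 − P_x) U_tΨ‖² equals one minus the overlap.
open scoped ComplexOrder in
theorem projOn_mulVec_eq_of_siteOverlap_eq_one (hψ : ∑ i, ‖ψ i‖ ^ 2 = 1) (hH : H.IsHermitian)
    {x : Site D L} {t : ℝ} (h : siteOverlap H (productState ψ D L) x t = 1) :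
    Matrix.mulVec (projOn ψ {x}) (Matrix.mulVec (propagator H t) (tensorPower ψ (Site D L))) =
      Matrix.mulVec (propagator H t) (tensorPower ψ (Site D L)) := by
  obtain ⟨U, hU⟩ : ∃ U, U = propagator H t := ⟨_, rfl⟩
  obtain ⟨Q, hQ⟩ : ∃ Q, Q = projOn ψ {x} := ⟨_, rfl⟩
  have hUU : star U * U = 1 := by
    have := star_propagator_mul hH t 1
    rw [mul_one, ← hU] at this
    rw [this]
    exact heis_one (𝒜 := Op D d L) H t
  have h1 : expect ψ (star U * Q * U) = 1 := by
    have h2 := expect_star_mul_self hψ {x} U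
    rw [hU, ← siteOverlap_eq_norm hψ, h, ← hU, ← hQ] at h2
    rw [← h2, Complex.ofReal_one]
  have hs : star (1 - Q) = 1 - Q := by rw [star_sub, star_one, hQ, star_projOn]
  have hQQ : (1 - Q) * (1 - Q) = 1 - Q := by
    have : Q * Q = Q := by rw [hQ, projOn_mul_projOn hψ, Finset.union_self]
    rw [mul_sub, sub_mul, sub_mul, this]
    simp
  have h3 : expect ψ (star ((1 - Q) * U) * ((1 - Q) * U)) = 0 := by
    have e : star ((1 - Q) * U) * ((1 - Q) * U) = 1 - star U * Q * U := by
      rw [star_mul, hs, mul_assoc, ← mul_assoc (1 - Q), hQQ, sub_mul, mul_sub, one_mul, hUU,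
        mul_assoc]
    rw [e, expect_sub, h1, expect_one hψ, sub_self]
  rw [← hU, ← hQ]
  rw [expect, Matrix.star_eq_conjTranspose, ← Matrix.mulVec_mulVec, Matrix.dotProduct_mulVec,
    ← Matrix.star_mulVec, dotProduct_star_self_eq_zero, ← Matrix.mulVec_mulVec,
    Matrix.sub_mulVec, Matrix.one_mulVec, sub_eq_zero] at h3
  exact h3.symm

/-- A vector fixed by every P_x is fixed by their product |Ψ⟩⟨Ψ|, hence is a multiple of Ψ. -/
theorem orthPart_propagator_eq_zero (hψ : ∑ i, ‖ψ i‖ ^ 2 = 1) (hH : H.IsHermitian)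
    {t : ℝ} (h : ∀ x, siteOverlap H (productState ψ D L) x t = 1) (σ : Config D d L) :
    orthPart ψ (propagator H t) σ = 0 := by
  obtain ⟨v, hv⟩ : ∃ v, v = Matrix.mulVec (propagator H t) (tensorPower ψ (Site D L)) := ⟨_, rfl⟩
  have h1 : ∀ S : Finset (Site D L), Matrix.mulVec (projOn ψ S) v = v := by
    intro S
    induction S using Finset.induction_on with
    | empty => rw [projOn_empty, Matrix.one_mulVec]
    | insert x S _ ih =>
      rw [Finset.insert_eq, ← projOn_mul_projOn hψ, ← Matrix.mulVec_mulVec, ih, hv]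
      exact projOn_mulVec_eq_of_siteOverlap_eq_one hψ hH (h x)
  have h2 := congrFun (h1 Finset.univ) σ
  rw [projOn_univ, Matrix.vecMulVec_mulVec] at h2
  rw [orthPart, expect, ← hv, ← h2]
  simp [mul_comm]

theorem analyticOnNhd_orthPart (ψ : Fin d → ℂ) (H : Op D d L) (σ : Config D d L) :
    AnalyticOnNhd ℝ (fun t : ℝ => orthPart ψ (propagator H t) σ) Set.univ := by
  intro t _
  obtain ⟨g, hg⟩ : ∃ g : ℝ → Op D d L, g = fun t => t • ((-Complex.I) • H) := ⟨_, rfl⟩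
  have h1 : AnalyticAt ℝ g t := by rw [hg]; exact analyticAt_id.smul analyticAt_const
  have h2 : AnalyticAt ℝ (NormedSpace.exp ∘ g) t :=
    (NormedSpace.exp_analytic (𝕂 := ℝ) (g t)).comp h1
  have h4 := (((orthPartLinear ψ σ).restrictScalars ℝ).toContinuousLinearMap.analyticAt
    (NormedSpace.exp (g t))).comp (f := NormedSpace.exp ∘ g) h2
  refine h4.congr (Filter.Eventually.of_forall fun s => ?_)
  have e : s • ((-Complex.I) • H) = (-(Complex.I * (s : ℂ))) • H := by
    rw [← Complex.coe_smul, smul_smul]; congr 1; ring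
  simp only [Function.comp_apply, hg, e]
  rfl

/-- Differentiating at t = 0 gives HΨ = ⟨H⟩Ψ. -/
theorem isEigenstate_of_orthPart_eq_zero (hψ : ∑ i, ‖ψ i‖ ^ 2 = 1)
    (h : ∀ (σ : Config D d L) (t : ℝ), orthPart ψ (propagator H t) σ = 0) :
    IsEigenstate H (productState ψ D L) := by
  have h1 : ∀ σ, orthPart ψ H σ = 0 := by
    intro σ
    have hd := hasDerivAt_exp_neg_I_smul (𝒜 := Op D d L) H 0
    have hd2 := ((orthPartLinear ψ σ).restrictScalars ℝ).toContinuousLinearMap.hasFDerivAt.comp_hasDerivAt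
      (0 : ℝ) hd
    have hd3 : HasDerivAt (fun t : ℝ => orthPart ψ (propagator H t) σ)
      (orthPart ψ (-(Complex.I • H) *
        NormedSpace.exp ((-(Complex.I * ((0 : ℝ) : ℂ))) • H)) σ) 0 := hd2
    simp only [h] at hd3
    have h0 := hd3.unique (hasDerivAt_const (0 : ℝ) (0 : ℂ))
    have e : -(Complex.I • H) * NormedSpace.exp ((-(Complex.I * ((0 : ℝ) : ℂ))) • H) =
        (-Complex.I) • H := by
      simp
    rw [e] at h0
    have h5 : orthPart ψ ((-Complex.I) • H) σ = (-Complex.I) • orthPart ψ H σ :=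
      (orthPartLinear ψ σ).map_smul _ _
    rw [h5] at h0
    simpa using h0
  refine ⟨expect ψ H, Module.End.hasEigenvector_iff.2 ⟨?_, ?_⟩⟩
  · rw [Module.End.mem_eigenspace_iff, Matrix.toLin'_apply]
    funext σ
    exact sub_eq_zero.1 (h1 σ)
  · intro h0
    have := star_tensorPower_dotProduct (T := Site D L) ψ hψ
    rw [← productState_eq, h0] at this
    simp at this

theorem countable_revival_times (hψ : ∑ i, ‖ψ i‖ ^ 2 = 1) (hH : H.IsHermitian)
    (hE : ¬ IsEigenstate H (productState ψ D L)) :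
    {t : ℝ | ∀ x, siteOverlap H (productState ψ D L) x t = 1}.Countable := by
  by_cases h : ∃ (σ : Config D d L) (t : ℝ), orthPart ψ (propagator H t) σ ≠ 0
  · obtain ⟨σ, t, ht⟩ := h
    refine (countable_zeros_of_analytic (analyticOnNhd_orthPart ψ H σ) ht).mono ?_
    intro s hs
    exact orthPart_propagator_eq_zero hψ hH hs σ
  · push Not at h
    exact absurd (isEigenstate_of_orthPart_eq_zero hψ h) hE

end Revival

/-- There are arbitrarily small times at which the rates of countably many systems are positive,
except where the product state is stationary. -/
theorem exists_small_time_rate_pos {D d : ℕ} {ψ : Fin d → ℂ} (hψ : ∑ i, ‖ψ i‖ ^ 2 = 1)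
    {r : ℕ} {J : ℝ} (h : ∀ (L : ℕ) [NeZero L], Site D L → Op D d L)
    (hh : ∀ (L : ℕ) [NeZero L], IsLocalHamiltonian r J (h L)) {δ : ℝ} (hδ : 0 < δ) :
    ∃ τ : ℝ, 0 < τ ∧ τ < δ ∧ ∀ (L : ℕ) [NeZero L],
      ¬ IsEigenstate (hamiltonian (h L)) (productState ψ D L) →
      ∀ x : Site D L, 0 < rate (hamiltonian (h L)) (productState ψ D L) x τ := by
  set bad : Set ℝ := ⋃ n : ℕ, {t | ¬ IsEigenstate (hamiltonian (h (n + 1)))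
    (productState ψ D (n + 1)) ∧
      ∀ x, siteOverlap (hamiltonian (h (n + 1))) (productState ψ D (n + 1)) x t = 1} with hbad
  have hc : bad.Countable := by
    refine Set.countable_iUnion fun n => ?_
    by_cases hE : IsEigenstate (hamiltonian (h (n + 1))) (productState ψ D (n + 1))
    · refine Set.countable_empty.mono ?_
      rintro t ⟨h1, -⟩
      exact h1 hE
    · exact (countable_revival_times hψ (hh (n + 1)).isHermitian hE).mono fun t ht => ht.2
  have hnc : ¬ (Set.Ioo 0 δ).Countable := by
    intro hcount
    have h1 := Cardinal.mk_Ioo_real hδ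
    have h2 := Cardinal.le_aleph0_iff_set_countable.2 hcount
    rw [h1] at h2
    exact absurd Cardinal.aleph0_lt_continuum (not_lt.2 h2)
  obtain ⟨τ, hτ, hτ'⟩ : ∃ τ ∈ Set.Ioo 0 δ, τ ∉ bad := by
    by_contra hcon
    push Not at hcon
    exact hnc (hc.mono hcon)
  refine ⟨τ, hτ.1, hτ.2, fun L _ hE x => ?_⟩
  rw [rate_pos_iff (siteOverlap_nonneg hψ _ x τ)]
  refine lt_of_le_of_ne (siteOverlap_le_one hψ (hh L).isHermitian x τ) fun h1 => hτ' ?_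
  -- The exceptional set is indexed by n + 1 so that each system size is nonzero by instance.
  obtain ⟨n, rfl⟩ : ∃ n, L = n + 1 := ⟨L - 1, by have := NeZero.pos L; omega⟩
  rw [hbad, Set.mem_iUnion]
  refine ⟨n, hE, fun y => ?_⟩
  rw [← h1]
  exact siteOverlap_eq_of_translationInvariant hψ (hh (n + 1)).isHermitian (hh (n + 1)).invariant
    τ y x

/-! ### Optimizing the sublattice spacing. -/

section Decay

/-- The exponent `(L^D k)^{1/(1+D)}` for a finite rate `k`. -/
def decayExponent (D L : ℕ) (k : ℝ) : ℝ := ((L : ℝ) ^ D * k) ^ (1 / (1 + (D : ℝ)))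

theorem decayExponent_nonneg (D L : ℕ) {k : ℝ} (hk : 0 ≤ k) : 0 ≤ decayExponent D L k :=
  Real.rpow_nonneg (by positivity) _

theorem decayExponent_pow (D L : ℕ) {k : ℝ} (hk : 0 ≤ k) :
    decayExponent D L k ^ (1 + D) = (L : ℝ) ^ D * k := by
  rw [decayExponent, one_div, ← Real.rpow_natCast, ← Real.rpow_mul (by positivity)]
  push_cast
  rw [inv_mul_cancel₀ (by positivity), Real.rpow_one]

theorem decay_ofReal (D L : ℕ) {k : ℝ} (hk : 0 ≤ k) :
    decay D L (ENNReal.ofReal k) = ENNReal.ofReal (Real.exp (-(decayExponent D L k / 4))) := by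
  have e1 : (L : ℝ≥0∞) ^ D * ENNReal.ofReal k = ENNReal.ofReal ((L : ℝ) ^ D * k) := by
    rw [ENNReal.ofReal_mul (by positivity), ENNReal.ofReal_pow (by positivity),
      ENNReal.ofReal_natCast]
  have e2 : ((L : ℝ≥0∞) ^ D * ENNReal.ofReal k) ^ (1 / (1 + (D : ℝ))) / 4 =
      ENNReal.ofReal (decayExponent D L k / 4) := by
    rw [e1, ENNReal.ofReal_rpow_of_nonneg (by positivity) (by positivity),
      ENNReal.ofReal_div_of_pos (by norm_num)]
    congr 1
    norm_num
  have h0 := decayExponent_nonneg D L hk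
  rw [decay, e2, EReal.coe_ennreal_ofReal, max_eq_left (by positivity), ← EReal.coe_neg,
    EReal.exp_coe]

/-- The constant in the fidelity bound, in terms of the Lieb–Robinson constant `Λ` and a lower bound
`κ` on the rate. -/
def fidelityConst (D : ℕ) (Λ κ : ℝ) : ℝ :=
  Real.exp 2 + 2 * Λ * Real.exp 3 * ((2 * (1 + D)).factorial * 4 ^ (2 * (1 + D))) / κ ^ 2

theorem pow_mul_exp_neg_le {X : ℝ} (hX : 0 ≤ X) (n : ℕ) :
    X ^ n * Real.exp (-(X / 4)) ≤ n.factorial * 4 ^ n := by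
  have h := Real.pow_div_factorial_le_exp (X / 4) (by positivity) n
  rw [div_le_iff₀ (by positivity), div_pow, div_le_iff₀ (by positivity)] at h
  calc X ^ n * Real.exp (-(X / 4)) ≤
      Real.exp (X / 4) * n.factorial * 4 ^ n * Real.exp (-(X / 4)) := by gcongr
    _ = (Real.exp (X / 4) * Real.exp (-(X / 4))) * (n.factorial * 4 ^ n) := by ring
    _ = _ := by rw [← Real.exp_add, add_neg_cancel, Real.exp_zero, one_mul]

/-- Optimization over the spacing of the sublattice in the fidelity bound. -/
theorem le_fidelityConst_mul_exp {D L : ℕ} (hL : 0 < L) {f k κ Λ : ℝ} (hΛ : 0 ≤ Λ)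
    (hκ : 0 < κ) (hk : κ ≤ k) (hf1 : f ≤ 1) (hfk : f ≤ Real.exp (-k))
    (hf : ∀ R ℓ m : ℕ, 2 * R + 1 ≤ ℓ → ℓ * m ≤ L →
      f ≤ Real.exp (-k) ^ (m ^ D) + 2 * (m : ℝ) ^ D * (Λ * ((L : ℝ) ^ D * Real.exp (-(2 * R))))) :
    f ≤ fidelityConst D Λ κ * Real.exp (-(decayExponent D L k / 4)) := by
  have hk0 : 0 < k := hκ.trans_le hk
  have hL0 : (0 : ℝ) < L := by exact_mod_cast hL
  obtain ⟨X, hX⟩ : ∃ X, X = decayExponent D L k := ⟨_, rfl⟩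
  have hX0 : 0 ≤ X := hX ▸ decayExponent_nonneg D L hk0.le
  have hXpow : X ^ (1 + D) = (L : ℝ) ^ D * k := hX ▸ decayExponent_pow D L hk0.le
  rw [← hX]
  have hC : Real.exp 2 ≤ fidelityConst D Λ κ := by
    rw [fidelityConst]
    have : 0 ≤ 2 * Λ * Real.exp 3 * ((2 * (1 + D)).factorial * 4 ^ (2 * (1 + D))) / κ ^ 2 := by
      positivity
    linarith
  have hE := Real.exp_pos (-(X / 4))
  -- For small X the bound follows from f ≤ 1. The threshold 6 makes the spacing ⌊X/2⌋ at least 3 in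
  -- the other case.
  by_cases hX6 : X < 6
  · calc f ≤ 1 := hf1
      _ ≤ Real.exp 2 * Real.exp (-(X / 4)) := by
          rw [← Real.exp_add]
          exact Real.one_le_exp (by linarith)
      _ ≤ _ := by gcongr
  have hX6 : 6 ≤ X := not_lt.1 hX6
  have h1C : 1 ≤ fidelityConst D Λ κ := le_trans (Real.one_le_exp (by norm_num)) hC
  -- When k is large compared with L, a single site is enough, since X ≤ 4k. Otherwise X ≤ L, so the
  -- spacing fits into the torus.
  by_cases hkL : (L : ℝ) ≤ 4 * k
  · have hX4 : X ≤ 4 * k := by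
      apply le_of_pow_le_pow_left₀ (n := 1 + D) (by omega) (by positivity)
      calc X ^ (1 + D) = (L : ℝ) ^ D * k := hXpow
        _ ≤ (4 * k) ^ D * (4 * k) := by gcongr; linarith
        _ = _ := by ring
    calc f ≤ Real.exp (-k) := hfk
      _ ≤ 1 * Real.exp (-(X / 4)) := by
          rw [one_mul]; exact Real.exp_le_exp.2 (by linarith)
      _ ≤ _ := by gcongr
  have hkL : 4 * k < L := not_le.1 hkL
  have hXL : X ≤ L := by
    apply le_of_pow_le_pow_left₀ (n := 1 + D) (by omega) (by positivity)
    calc X ^ (1 + D) = (L : ℝ) ^ D * k := hXpow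
      _ ≤ (L : ℝ) ^ D * L := by gcongr; linarith
      _ = _ := by ring
  obtain ⟨ℓ, hℓ⟩ : ∃ ℓ, ℓ = ⌊X / 2⌋₊ := ⟨_, rfl⟩
  have hℓ1 : (ℓ : ℝ) ≤ X / 2 := hℓ ▸ Nat.floor_le (by positivity)
  have hℓ2 : X / 2 < ℓ + 1 := hℓ ▸ Nat.lt_floor_add_one _
  have hℓ3 : 3 ≤ ℓ := by rw [hℓ]; exact Nat.le_floor (by push_cast; linarith)
  have hℓL : ℓ ≤ L := by
    have : (ℓ : ℝ) ≤ L := by linarith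
    exact_mod_cast this
  obtain ⟨m, hm⟩ : ∃ m, m = L / ℓ := ⟨_, rfl⟩
  have hm1 : 1 ≤ m := by rw [hm]; exact (Nat.one_le_div_iff (by omega)).2 hℓL
  have hm2 : ℓ * m ≤ L := by rw [hm]; exact Nat.mul_div_le L ℓ
  have hm3 : L < ℓ * (m + 1) := by
    rw [hm]; exact Nat.lt_mul_div_succ L (by omega)
  have hmL : m ≤ L := by rw [hm]; exact Nat.div_le_self _ _
  -- As m ≥ 1, rounding L/ℓ down costs at most a factor 2, which the choice ℓ ≤ X/2 absorbs.
  have hmX : (L : ℝ) ≤ X * m := by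
    have h1 : (L : ℝ) ≤ ℓ * (m + 1) := by exact_mod_cast hm3.le
    have h2 : (1 : ℝ) ≤ m := by exact_mod_cast hm1
    calc (L : ℝ) ≤ ℓ * (m + 1) := h1
      _ ≤ (X / 2) * (m + m) := by gcongr
      _ = X * m := by ring
  obtain ⟨R, hR⟩ : ∃ R, R = (ℓ - 1) / 2 := ⟨_, rfl⟩
  have hR1 : 2 * R + 1 ≤ ℓ := by omega
  have hR2 : ℓ ≤ 2 * R + 2 := by omega
  have hR3 : X / 2 - 3 ≤ 2 * R := by
    have : (ℓ : ℝ) ≤ 2 * R + 2 := by exact_mod_cast hR2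
    linarith
  have key := hf R ℓ m hR1 hm2
  -- This balance fixes the exponent 1/(1 + D): m ≥ L/X gives m^D k ≥ L^D k / X^D = X.
  have hXm : X ≤ m ^ D * k := by
    have hXD : 0 < X ^ D := by positivity
    apply le_of_mul_le_mul_left _ hXD
    calc X ^ D * X = (L : ℝ) ^ D * k := by rw [← hXpow]; ring
      _ ≤ (X * m) ^ D * k := by gcongr
      _ = X ^ D * (m ^ D * k) := by ring
  have t1 : Real.exp (-k) ^ (m ^ D) ≤ Real.exp 2 * Real.exp (-(X / 4)) := by
    rw [← Real.exp_nat_mul, ← Real.exp_add]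
    apply Real.exp_le_exp.2
    push_cast
    linarith
  -- The lower bound on the rate controls the volume by a power of X, so that e^{-X/4} can absorb
  -- the factor L^{2D} in the error.
  have hN : (L : ℝ) ^ D ≤ X ^ (1 + D) / κ := by
    rw [le_div_iff₀ hκ, hXpow]
    gcongr
  have t2 : 2 * (m : ℝ) ^ D * (Λ * ((L : ℝ) ^ D * Real.exp (-(2 * R)))) ≤
      2 * Λ * Real.exp 3 * ((2 * (1 + D)).factorial * 4 ^ (2 * (1 + D))) / κ ^ 2 *
        Real.exp (-(X / 4)) := by
    have hmLr : (m : ℝ) ≤ L := by exact_mod_cast hmL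
    have e1 : Real.exp (-(2 * R)) ≤ Real.exp 3 * (Real.exp (-(X / 4)) * Real.exp (-(X / 4))) := by
      rw [← Real.exp_add, ← Real.exp_add]
      apply Real.exp_le_exp.2
      linarith
    calc 2 * (m : ℝ) ^ D * (Λ * ((L : ℝ) ^ D * Real.exp (-(2 * R))))
        ≤ 2 * (L : ℝ) ^ D * (Λ * ((L : ℝ) ^ D * (Real.exp 3 *
          (Real.exp (-(X / 4)) * Real.exp (-(X / 4)))))) := by gcongr
      _ ≤ 2 * (X ^ (1 + D) / κ) * (Λ * ((X ^ (1 + D) / κ) * (Real.exp 3 *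
          (Real.exp (-(X / 4)) * Real.exp (-(X / 4)))))) := by gcongr
      _ = 2 * Λ * Real.exp 3 * (X ^ (2 * (1 + D)) * Real.exp (-(X / 4))) / κ ^ 2 *
          Real.exp (-(X / 4)) := by
          rw [pow_mul', pow_two, pow_two]
          field_simp
      _ ≤ _ := by
          have e := pow_mul_exp_neg_le hX0 (2 * (1 + D))
          exact mul_le_mul_of_nonneg_right (div_le_div_of_nonneg_right
            (mul_le_mul_of_nonneg_left e (by positivity)) (by positivity)) hE.le
  rw [fidelityConst, add_mul]
  linarith

end Decay

/-! ### The fidelity bound for rates bounded below. -/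

section Bound

variable {D d L : ℕ} [NeZero L] {ψ : Fin d → ℂ} {r : ℕ} {J : ℝ} {h : Site D L → Op D d L}

theorem fidelity_sq_le_of_rate_eq_top (hψ : ∑ i, ‖ψ i‖ ^ 2 = 1) {H : Op D d L}
    (hH : H.IsHermitian) {x : Site D L} {t : ℝ}
    (h0 : siteOverlap H (productState ψ D L) x t = 0) :
    ENNReal.ofReal (fidelity H (productState ψ D L) t ^ 2) = 0 := by
  rw [ENNReal.ofReal_eq_zero, ← h0]
  exact fidelity_sq_le_siteOverlap hψ hH x t

theorem lrConst_nonneg (D r : ℕ) {J t : ℝ} (hJ : 0 ≤ J) (ht : 0 ≤ t) : 0 ≤ lrConst D r J t := by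
  rw [lrConst]; positivity

theorem IsLocalHamiltonian.ofReal_fidelity_sq_le (hh : IsLocalHamiltonian r J h)
    (hψ : ∑ i, ‖ψ i‖ ^ 2 = 1) {t κ : ℝ} (ht : 0 ≤ t) (hκ : 0 < κ) (x : Site D L)
    (hk : ENNReal.ofReal κ ≤ rate (hamiltonian h) (productState ψ D L) x t) :
    ENNReal.ofReal (fidelity (hamiltonian h) (productState ψ D L) t ^ 2) ≤
      ((fidelityConst D (lrConst D r J t) κ).toNNReal : ℝ≥0∞) *
        decay D L (rate (hamiltonian h) (productState ψ D L) x t) := by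
  -- Zero overlap means an infinite rate and a vanishing right-hand side; the fidelity then vanishes
  -- too, since its square is at most the overlap.
  rcases (siteOverlap_nonneg hψ (hamiltonian h) x t).eq_or_lt with h0 | h0
  · rw [fidelity_sq_le_of_rate_eq_top hψ hh.isHermitian h0.symm]
    exact zero_le
  · rw [rate_eq_ofReal h0] at hk ⊢
    have hp1 := siteOverlap_le_one hψ hh.isHermitian x t
    set p := siteOverlap (hamiltonian h) (productState ψ D L) x t with hp
    have hk0 : 0 ≤ -Real.log p := by
      have := Real.log_nonpos h0.le hp1
      linarith
    have hk' : κ ≤ -Real.log p := (ENNReal.ofReal_le_ofReal_iff hk0).1 hk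
    have hpe : Real.exp (-(-Real.log p)) = p := by rw [neg_neg, Real.exp_log h0]
    have hF := fidelity_sq_le_siteOverlap hψ hh.isHermitian x t
    rw [decay_ofReal D L hk0, ← ENNReal.ofReal, ← ENNReal.ofReal_mul' (Real.exp_pos _).le]
    apply ENNReal.ofReal_le_ofReal
    apply le_fidelityConst_mul_exp (NeZero.pos L) (lrConst_nonneg D r hh.nonneg ht) hκ hk'
      (hF.trans hp1) (by rw [hpe]; exact hF)
    intro R ℓ m hR hm
    rw [hpe]
    exact hh.fidelity_sq_le hψ ht x hR hm

end Bound

/-! ### Fixed interactions and the thermodynamic limit. -/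

section Interaction

open scoped Matrix.Norms.L2Operator

variable {D d : ℕ} {S : Finset (Fin D → ℤ)}

/-- The range of an interaction: the largest modulus of a coordinate of a site in `S`. -/
def interactionRange (S : Finset (Fin D → ℤ)) : ℕ :=
  S.sup fun s => Finset.univ.sup fun i => (s i).natAbs

theorem natAbs_le_interactionRange {s : Fin D → ℤ} (hs : s ∈ S) (i : Fin D) :
    (s i).natAbs ≤ interactionRange S :=
  (Finset.le_sup (f := fun i => (s i).natAbs) (Finset.mem_univ i)).trans
    (Finset.le_sup (f := fun s : Fin D → ℤ => Finset.univ.sup fun i => (s i).natAbs) hs)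

theorem eq_of_intCast_eq {L R : ℕ} (hL : 2 * R + 1 ≤ L) {a b : ℤ} (ha : a.natAbs ≤ R)
    (hb : b.natAbs ≤ R) (h : (a : ZMod L) = b) : a = b := by
  rw [ZMod.intCast_eq_intCast_iff_dvd_sub] at h
  have := Int.eq_zero_of_abs_lt_dvd h (by rw [Int.abs_eq_natAbs]; omega)
  omega

theorem injective_interaction_sites {L : ℕ} (hL : 2 * interactionRange S + 1 ≤ L) (x : Site D L) :
    Function.Injective
      (fun (s : S) (i : Fin D) => x i + ((s : Fin D → ℤ) i : ZMod L)) := by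
  intro s s' h
  apply Subtype.ext
  funext i
  exact eq_of_intCast_eq hL (natAbs_le_interactionRange s.2 i) (natAbs_le_interactionRange s'.2 i)
    (add_left_cancel (congrFun h i))

theorem isLocalHamiltonian_interactionTerm {L : ℕ} [NeZero L]
    (hL : 2 * interactionRange S + 1 ≤ L) {g : Matrix (S → Fin d) (S → Fin d) ℂ}
    (hg : g.IsHermitian) :
    IsLocalHamiltonian (interactionRange S) ‖g‖ (interactionTerm g L) where
  hermitian x := by
    have h1 := map_star (tensorEmbedHom (d := d) (injective_interaction_sites hL x)) g
    rw [tensorEmbedHom_apply, tensorEmbedHom_apply] at h1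
    have h2 : star g = g := hg
    rw [h2] at h1
    exact h1.symm
  strictly_local x := by
    have hmem : ∀ s : S, (fun i => x i + ((s : Fin D → ℤ) i : ZMod L)) ∈
        ball x (interactionRange S) := by
      intro s
      refine ⟨s, fun i => ?_, fun i => rfl⟩
      rw [Int.abs_eq_natAbs]
      exact_mod_cast natAbs_le_interactionRange s.2 i
    refine ⟨tensorEmbed (fun s : S => ⟨_, hmem s⟩) g, ?_⟩
    rw [embed_eq_tensorEmbed, tensorEmbed_comp Subtype.val_injective]
    rfl
  bounded x := norm_tensorEmbed_le (injective_interaction_sites hL x) g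
  invariant := by
    intro a σ σ'
    simp only [hamiltonian, Matrix.sum_apply]
    rw [← Equiv.sum_comp (Equiv.addRight a) (fun x => interactionTerm g L x σ σ')]
    refine Finset.sum_congr rfl fun x _ => ?_
    change _ = interactionTerm g L (x + a) σ σ'
    simp only [interactionTerm, embed, Matrix.of_apply]
    have e : ∀ s : S, (fun i => x i + ((s : Fin D → ℤ) i : ZMod L)) + a =
        fun i => (x + a) i + ((s : Fin D → ℤ) i : ZMod L) := by
      intro s
      funext i
      simp only [Pi.add_apply]
      ring
    simp only [e]
    have hiff : (∀ y, y ∉ Set.range (fun (s : S) (i : Fin D) =>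
          x i + ((s : Fin D → ℤ) i : ZMod L)) → σ (y + a) = σ' (y + a)) ↔
        ∀ y, y ∉ Set.range (fun (s : S) (i : Fin D) =>
          (x + a) i + ((s : Fin D → ℤ) i : ZMod L)) → σ y = σ' y := by
      refine ⟨fun h y hy => ?_, fun h y hy => h _ ?_⟩
      · have := h (y - a) (by
          rintro ⟨s, hs⟩
          apply hy
          refine ⟨s, ?_⟩
          have e' := e s
          beta_reduce at hs ⊢
          rw [← e', hs, sub_add_cancel])
        rwa [sub_add_cancel] at this
      · rintro ⟨s, hs⟩
        apply hy
        refine ⟨s, ?_⟩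
        beta_reduce at hs ⊢
        rw [← e] at hs
        exact add_right_cancel hs
    by_cases h : ∀ y, y ∉ Set.range (fun (s : S) (i : Fin D) =>
        x i + ((s : Fin D → ℤ) i : ZMod L)) → σ (y + a) = σ' (y + a)
    · rw [if_pos h, if_pos (hiff.1 h)]
    · rw [if_neg h, if_neg fun h' => h (hiff.2 h')]

/-- The box of side `2 R + 1` around the origin of `ℤ^D`. -/
def box (D R : ℕ) : Finset (Fin D → ℤ) := Fintype.piFinset fun _ => Finset.Icc (-(R : ℤ)) R

theorem mem_box {R : ℕ} {z : Fin D → ℤ} : z ∈ box D R ↔ ∀ i, (z i).natAbs ≤ R := by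
  rw [box, Fintype.mem_piFinset]
  refine forall_congr' fun i => ?_
  rw [Finset.mem_Icc]
  omega

/-- Reduction modulo `L` on a box. -/
def boxSite (D R L : ℕ) (z : box D R) : Site D L := fun i => ((z : Fin D → ℤ) i : ZMod L)

theorem boxSite_injective {R L : ℕ} (hL : 2 * R + 1 ≤ L) :
    Function.Injective (boxSite D R L) := by
  intro z z' h
  apply Subtype.ext
  funext i
  exact eq_of_intCast_eq hL (mem_box.1 z.2 i) (mem_box.1 z'.2 i) (congrFun h i)

/-- The origin, as a site of a box. -/
def boxOrigin (D R : ℕ) : box D R := ⟨0, mem_box.2 fun i => by simp⟩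

open Classical in
/-- The sites `u + s`, `s ∈ S`, as sites of a box that contains them. -/
def boxShift (S : Finset (Fin D → ℤ)) (R : ℕ) (u : Fin D → ℤ) (s : S) : box D R :=
  if h : u + (s : Fin D → ℤ) ∈ box D R then ⟨_, h⟩ else boxOrigin D R

/-- The Hamiltonian of an interaction on a box, with the terms that are supported in it. -/
def boxHamiltonian (g : Matrix (S → Fin d) (S → Fin d) ℂ) (R : ℕ) :
    Matrix (box D R → Fin d) (box D R → Fin d) ℂ :=
  ∑ u ∈ box D (R - interactionRange S), tensorEmbed (boxShift S R u) g

/-- For 2R + 1 ≤ L the ball of radius R does not wrap around the torus, so reduction modulo L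
identifies it with a box in ℤ^D. The retained terms are those centred in the box of radius R minus
the range; for them the default value in `boxShift` never occurs. -/
theorem localEvolution_interactionTerm {R L : ℕ} [NeZero L] (hR : interactionRange S ≤ R)
    (hL : 2 * R + 1 ≤ L) (ψ : Fin d → ℂ) (g : Matrix (S → Fin d) (S → Fin d) ℂ) (t : ℝ) :
    localEvolution ψ (interactionTerm g L) (interactionRange S) R t 0 =
      tensorEmbed (boxSite D R L) (heis (boxHamiltonian g R) t (projOn ψ {boxOrigin D R})) := by
  have hι := boxSite_injective (D := D) hL
  have e1 : tensorEmbed (boxSite D R L) (projOn ψ {boxOrigin D R}) = projOn ψ {(0 : Site D L)} := by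
    rw [tensorEmbed_projOn_singleton hι]
    congr 2
    funext i
    simp [boxSite, boxOrigin]
  have e2 : tensorEmbed (boxSite D R L) (boxHamiltonian g R) =
      ∑ z ∈ Finset.univ.filter (fun z : Site D L => torusNorm (z - 0) + interactionRange S ≤ R),
        interactionTerm g L z := by
    rw [boxHamiltonian, ← tensorEmbedHom_apply hι, map_sum]
    refine Finset.sum_bij (fun u _ i => ((u i : ℤ) : ZMod L)) ?_ ?_ ?_ ?_
    · intro u hu
      rw [mem_box] at hu
      have h1 : torusNorm ((fun i => ((u i : ℤ) : ZMod L)) - 0 : Site D L) ≤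
          R - interactionRange S := by
        rw [sub_zero, torusNorm_le_iff]
        exact fun i => (natAbs_valMinAbs_intCast_le _).trans (hu i)
      simp only [Finset.mem_filter, Finset.mem_univ, true_and]
      omega
    · intro u hu u' hu' h
      rw [mem_box] at hu hu'
      funext i
      have h1 := hu i
      have h2 := hu' i
      exact eq_of_intCast_eq hL (by omega) (by omega) (congrFun h i)
    · intro z hz
      simp only [Finset.mem_filter, Finset.mem_univ, true_and, sub_zero] at hz
      refine ⟨fun i => (z i).valMinAbs, mem_box.2 fun i => ?_, ?_⟩
      · have := torusNorm_le_iff.1 (le_refl (torusNorm z)) i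
        omega
      · funext i
        simp
    · intro u hu
      rw [tensorEmbedHom_apply, tensorEmbed_comp hι, interactionTerm, embed_eq_tensorEmbed]
      congr 1
      funext s i
      have hmem : u + (s : Fin D → ℤ) ∈ box D R := by
        rw [mem_box] at hu ⊢
        intro i
        have h1 := hu i
        have h2 := natAbs_le_interactionRange s.2 i
        rw [Pi.add_apply]
        omega
      simp [boxShift, boxSite, dif_pos hmem]
  rw [tensorEmbed_heis hι, e1, e2, localEvolution]

theorem expect_localEvolution_interactionTerm {ψ : Fin d → ℂ} (hψ : ∑ i, ‖ψ i‖ ^ 2 = 1)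
    {R L : ℕ} [NeZero L] (hR : interactionRange S ≤ R)
    (hL : 2 * R + 1 ≤ L) (g : Matrix (S → Fin d) (S → Fin d) ℂ) (t : ℝ) :
    expect ψ (localEvolution ψ (interactionTerm g L) (interactionRange S) R t 0) =
      expect ψ (heis (boxHamiltonian g R) t (projOn ψ {boxOrigin D R})) := by
  rw [localEvolution_interactionTerm hR hL, expect, expect]
  exact expectation_tensorEmbed ψ hψ (boxSite_injective hL) _

/-- The single-site overlap on the torus is close to one computed on a box, which does not depend
on the size of the torus. -/
theorem norm_siteOverlap_sub_le {ψ : Fin d → ℂ} (hψ : ∑ i, ‖ψ i‖ ^ 2 = 1)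
    {g : Matrix (S → Fin d) (S → Fin d) ℂ} (hg : g.IsHermitian) {t : ℝ} (ht : 0 ≤ t)
    {R L : ℕ} [NeZero L] (hR : interactionRange S ≤ R) (hL : 2 * R + 1 ≤ L) :
    ‖(siteOverlap (hamiltonian (interactionTerm g L)) (productState ψ D L) 0 t : ℂ) -
      expect ψ (heis (boxHamiltonian g R) t (projOn ψ {boxOrigin D R}))‖ ≤
      lrConst D (interactionRange S) ‖g‖ t * ((L : ℝ) ^ D * Real.exp (-(2 * R))) := by
  have hh := isLocalHamiltonian_interactionTerm (L := L) (by omega) hg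
  have h1 := hh.norm_heis_sub_localEvolution_le hψ ht R 0
  have h2 := norm_expect_le hψ (heis (hamiltonian (interactionTerm g L)) t (projOn ψ {0}) -
    localEvolution ψ (interactionTerm g L) (interactionRange S) R t 0)
  rw [expect_sub, ← ofReal_siteOverlap hψ hh.isHermitian,
    expect_localEvolution_interactionTerm hψ hR hL] at h2
  exact h2.trans h1

theorem exists_dist_siteOverlap_le (ψ : Fin d → ℂ) (hψ : ∑ i, ‖ψ i‖ ^ 2 = 1)
    (g : Matrix (S → Fin d) (S → Fin d) ℂ) (hg : g.IsHermitian) {t : ℝ} (ht : 0 ≤ t) :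
    ∃ A : ℝ, ∀ n : ℕ,
      dist (siteOverlap (hamiltonian (interactionTerm g (n + 2 * interactionRange S + 1)))
          (productState ψ D (n + 2 * interactionRange S + 1)) 0 t)
        (siteOverlap (hamiltonian (interactionTerm g (n + 1 + 2 * interactionRange S + 1)))
          (productState ψ D (n + 1 + 2 * interactionRange S + 1)) 0 t) ≤
      A * Real.exp (-(1 / 2)) ^ n := by
  set Λ := lrConst D (interactionRange S) ‖g‖ t with hΛ
  have hΛ0 : 0 ≤ Λ := lrConst_nonneg _ _ (norm_nonneg g) ht
  refine ⟨2 * Λ * (D.factorial * 2 ^ D * Real.exp 3), fun n => ?_⟩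
  obtain ⟨L, hL⟩ : ∃ L, L = n + 2 * interactionRange S + 1 := ⟨_, rfl⟩
  -- The same box is compared with the tori of sides L and L + 1. The offset in L ensures that R is
  -- at least the range; moreover 2R + 1 ≤ L ≤ 2R + 2, so the error decays in L.
  obtain ⟨R, hR⟩ : ∃ R, R = (L - 1) / 2 := ⟨_, rfl⟩
  have h1 := norm_siteOverlap_sub_le hψ hg ht (R := R) (L := n + 2 * interactionRange S + 1)
    (by omega) (by omega)
  have h2 := norm_siteOverlap_sub_le hψ hg ht (R := R) (L := n + 1 + 2 * interactionRange S + 1)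
    (by omega) (by omega)
  rw [← hΛ] at h1 h2
  have hbound : ∀ M : ℕ, M ≤ L + 1 → Λ * ((M : ℝ) ^ D * Real.exp (-(2 * R))) ≤
      Λ * (D.factorial * 2 ^ D * Real.exp 3) * Real.exp (-(1 / 2)) ^ n := by
    intro M hM
    have hM' : (M : ℝ) ≤ L + 1 := by exact_mod_cast hM
    have hR' : (L : ℝ) ≤ 2 * R + 2 := by
      have : L ≤ 2 * R + 2 := by omega
      exact_mod_cast this
    have hn : (n : ℝ) ≤ L := by
      have : n ≤ L := by omega
      exact_mod_cast this
    have hL0 : (0 : ℝ) ≤ L := by positivity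
    -- The volume factor costs e^{(L+1)/2} out of e^{-2R} ≤ e^{2−L}, which leaves the geometric
    -- ratio e^{-1/2}.
    have e1 : (M : ℝ) ^ D ≤ D.factorial * 2 ^ D * Real.exp ((L + 1) / 2) := by
      have := Real.pow_div_factorial_le_exp (((L : ℝ) + 1) / 2) (by positivity) D
      rw [div_le_iff₀ (by positivity), div_pow, div_le_iff₀ (by positivity)] at this
      calc (M : ℝ) ^ D ≤ ((L : ℝ) + 1) ^ D := by gcongr
        _ ≤ _ := this
        _ = _ := by ring
    rw [mul_assoc]
    refine mul_le_mul_of_nonneg_left ?_ hΛ0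
    calc (M : ℝ) ^ D * Real.exp (-(2 * R)) ≤
        D.factorial * 2 ^ D * Real.exp ((L + 1) / 2) * Real.exp (-(2 * R)) := by gcongr
      _ = D.factorial * 2 ^ D * Real.exp ((L + 1) / 2 + -(2 * R)) := by
          rw [mul_assoc, ← Real.exp_add]
      _ ≤ D.factorial * 2 ^ D * Real.exp (3 + n * -(1 / 2)) := by
          have := Real.exp_le_exp.2 (show ((L : ℝ) + 1) / 2 + -(2 * R) ≤ 3 + n * -(1 / 2) by linarith)
          gcongr
      _ = _ := by rw [Real.exp_add, Real.exp_nat_mul]; ring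
  have h1' := h1.trans (hbound _ (by omega))
  have h2' := h2.trans (hbound _ (by omega))
  rw [← Complex.isometry_ofReal.dist_eq, dist_eq_norm]
  have h3 := norm_sub_le_norm_sub_add_norm_sub
    (siteOverlap (hamiltonian (interactionTerm g (n + 2 * interactionRange S + 1)))
      (productState ψ D (n + 2 * interactionRange S + 1)) 0 t : ℂ)
    (expect ψ (heis (boxHamiltonian g R) t (projOn ψ {boxOrigin D R})))
    (siteOverlap (hamiltonian (interactionTerm g (n + 1 + 2 * interactionRange S + 1)))
      (productState ψ D (n + 1 + 2 * interactionRange S + 1)) 0 t : ℂ)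
  rw [norm_sub_rev (expect ψ _)] at h3
  linarith

/-- The single-site overlap converges exponentially fast in the thermodynamic limit. -/
theorem exists_limit_siteOverlap (ψ : Fin d → ℂ) (hψ : ∑ i, ‖ψ i‖ ^ 2 = 1)
    (g : Matrix (S → Fin d) (S → Fin d) ℂ) (hg : g.IsHermitian) {t : ℝ} (ht : 0 ≤ t) :
    ∃ A p : ℝ, ∀ (L : ℕ) [NeZero L], 2 * interactionRange S + 1 ≤ L → ∀ x : Site D L,
      |siteOverlap (hamiltonian (interactionTerm g L)) (productState ψ D L) x t - p| ≤
        A * Real.exp (-(L / 2)) := by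
  obtain ⟨A, hA⟩ := exists_dist_siteOverlap_le (D := D) ψ hψ g hg ht
  have hr1 : Real.exp (-(1 / 2)) < 1 := by rw [Real.exp_lt_one_iff]; norm_num
  obtain ⟨p, hp⟩ := cauchySeq_tendsto_of_complete (cauchySeq_of_le_geometric _ _ hr1 hA)
  refine ⟨A / (1 - Real.exp (-(1 / 2))) * Real.exp ((2 * interactionRange S + 1 : ℕ) / 2), p, ?_⟩
  intro L _ hL x
  have hlim := dist_le_of_le_geometric_of_tendsto _ _ hr1 hA hp (L - (2 * interactionRange S + 1))
  have hh := isLocalHamiltonian_interactionTerm hL hg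
  rw [siteOverlap_eq_of_translationInvariant hψ hh.isHermitian hh.invariant t x 0]
  obtain ⟨n, rfl⟩ : ∃ n, L = n + 2 * interactionRange S + 1 :=
    ⟨L - (2 * interactionRange S + 1), by omega⟩
  have e : n + 2 * interactionRange S + 1 - (2 * interactionRange S + 1) = n := by omega
  rw [e, Real.dist_eq] at hlim
  refine hlim.trans (le_of_eq ?_)
  have e2 : Real.exp (-(1 / 2)) ^ n = Real.exp ((2 * interactionRange S + 1 : ℕ) / 2) *
      Real.exp (-(((n + 2 * interactionRange S + 1 : ℕ) : ℝ) / 2)) := by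
    rw [← Real.exp_nat_mul, ← Real.exp_add]
    congr 1
    push_cast
    ring
  rw [e2]
  ring

/-- When the overlap tends to 1 at the rate e^{-L/2}, so does k to 0. Then L^D k is bounded, the
right-hand exponential is bounded away from zero, and F ≤ 1 suffices. -/
theorem exists_decay_bound_of_rate_small {ψ : Fin d → ℂ} (hψ : ∑ i, ‖ψ i‖ ^ 2 = 1)
    {g : Matrix (S → Fin d) (S → Fin d) ℂ} (hg : g.IsHermitian) {t A : ℝ}
    (hA : ∀ (L : ℕ) [NeZero L], 2 * interactionRange S + 1 ≤ L → ∀ x : Site D L,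
      |siteOverlap (hamiltonian (interactionTerm g L)) (productState ψ D L) x t - 1| ≤
        A * Real.exp (-(L / 2))) :
    ∃ (C : ℝ≥0) (L₀ : ℕ), ∀ (L : ℕ) [NeZero L], L₀ ≤ L → ∀ x : Site D L,
      ENNReal.ofReal (fidelity (hamiltonian (interactionTerm g L)) (productState ψ D L) t ^ 2) ≤
        (C : ℝ≥0∞) * decay D L (rate (hamiltonian (interactionTerm g L))
          (productState ψ D L) x t) := by
  have hev : ∀ᶠ L : ℕ in Filter.atTop, A * Real.exp (-((L : ℝ) / 2)) ≤ 1 / 2 := by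
    have h1 : Filter.Tendsto (fun L : ℕ => A * Real.exp (-((L : ℝ) / 2))) Filter.atTop
        (nhds (A * 0)) :=
      (Real.tendsto_exp_neg_atTop_nhds_zero.comp
        ((tendsto_natCast_atTop_atTop (R := ℝ)).atTop_div_const (by norm_num))).const_mul A
    rw [mul_zero] at h1
    exact h1.eventually_le_const (by norm_num)
  obtain ⟨L₁, hL₁⟩ := Filter.eventually_atTop.1 hev
  set M : ℝ := (D.factorial * 4 ^ D) * (2 * |A|) with hM
  have hM0 : 0 ≤ M := by positivity
  refine ⟨(Real.exp (M ^ (1 / (1 + (D : ℝ))) / 4)).toNNReal,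
    max L₁ (2 * interactionRange S + 1), fun L _ hL x => ?_⟩
  have hL1 : L₁ ≤ L := (le_max_left _ _).trans hL
  have hL2 : 2 * interactionRange S + 1 ≤ L := (le_max_right _ _).trans hL
  have hh := isLocalHamiltonian_interactionTerm hL2 hg
  have hp := hA L hL2 x
  have hp1 := siteOverlap_le_one hψ hh.isHermitian x t
  have hF := fidelity_sq_le_siteOverlap hψ hh.isHermitian x t
  have hhalf := hL₁ L hL1
  set p := siteOverlap (hamiltonian (interactionTerm g L)) (productState ψ D L) x t with hpdef
  have hp' := (abs_le.1 hp).1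
  have hp0 : 1 / 2 ≤ p := by linarith
  have hppos : 0 < p := by linarith
  rw [rate_eq_ofReal hppos, ← hpdef]
  have hk0 : 0 ≤ -Real.log p := by
    have := Real.log_nonpos hppos.le hp1
    linarith
  have hk : -Real.log p ≤ 2 * (|A| * Real.exp (-(L / 2))) := by
    have h1 := Real.one_sub_inv_le_log_of_pos hppos
    -- Equivalent to (1 − p)(2p − 1) ≥ 0, which is why p ≥ 1/2 was arranged.
    have h2 : p⁻¹ ≤ 1 + 2 * (1 - p) := by
      rw [inv_le_iff_one_le_mul₀ hppos]
      nlinarith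
    have h3 : A * Real.exp (-(L / 2)) ≤ |A| * Real.exp (-(L / 2)) := by
      gcongr; exact le_abs_self A
    linarith
  have hNk : (L : ℝ) ^ D * -Real.log p ≤ M := by
    have h4 : (L : ℝ) ^ D * Real.exp (-(L / 4)) ≤ D.factorial * 4 ^ D :=
      pow_mul_exp_neg_le (by positivity) D
    have h5 : Real.exp (-((L : ℝ) / 2)) ≤ Real.exp (-(L / 4)) := by
      apply Real.exp_le_exp.2
      have : (0 : ℝ) ≤ L := by positivity
      linarith
    calc (L : ℝ) ^ D * -Real.log p ≤ (L : ℝ) ^ D * (2 * (|A| * Real.exp (-(L / 4)))) := by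
          gcongr
          exact hk.trans (by gcongr)
      _ = ((L : ℝ) ^ D * Real.exp (-(L / 4))) * (2 * |A|) := by ring
      _ ≤ _ := by rw [hM]; gcongr
  rw [decay_ofReal D L hk0, ← ENNReal.ofReal, ← ENNReal.ofReal_mul' (Real.exp_pos _).le]
  apply ENNReal.ofReal_le_ofReal
  refine (hF.trans hp1).trans ?_
  rw [← Real.exp_add]
  apply Real.one_le_exp
  have : decayExponent D L (-Real.log p) ≤ M ^ (1 / (1 + (D : ℝ))) :=
    Real.rpow_le_rpow (by positivity) hNk (by positivity)
  linarith

theorem exists_decay_bound_of_limit_lt_one {ψ : Fin d → ℂ} (hψ : ∑ i, ‖ψ i‖ ^ 2 = 1)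
    {g : Matrix (S → Fin d) (S → Fin d) ℂ} (hg : g.IsHermitian) {t A p₀ : ℝ} (ht : 0 ≤ t)
    (hp₀ : p₀ < 1)
    (hA : ∀ (L : ℕ) [NeZero L], 2 * interactionRange S + 1 ≤ L → ∀ x : Site D L,
      |siteOverlap (hamiltonian (interactionTerm g L)) (productState ψ D L) x t - p₀| ≤
        A * Real.exp (-(L / 2))) :
    ∃ (C : ℝ≥0) (L₀ : ℕ), ∀ (L : ℕ) [NeZero L], L₀ ≤ L → ∀ x : Site D L,
      ENNReal.ofReal (fidelity (hamiltonian (interactionTerm g L)) (productState ψ D L) t ^ 2) ≤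
        (C : ℝ≥0∞) * decay D L (rate (hamiltonian (interactionTerm g L))
          (productState ψ D L) x t) := by
  -- The overlap is eventually at most q, so κ = −log q bounds the rate below. The maximum with 1/2
  -- keeps q positive whatever the sign of p₀.
  obtain ⟨q, hq0, hq1, hq⟩ : ∃ q : ℝ, 0 < q ∧ q < 1 ∧ p₀ < q :=
    ⟨max (1 / 2) ((1 + p₀) / 2), lt_max_of_lt_left (by norm_num),
      max_lt (by norm_num) (by linarith), lt_max_of_lt_right (by linarith)⟩
  have hev : ∀ᶠ L : ℕ in Filter.atTop, A * Real.exp (-((L : ℝ) / 2)) ≤ q - p₀ := by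
    have h1 : Filter.Tendsto (fun L : ℕ => A * Real.exp (-((L : ℝ) / 2))) Filter.atTop
        (nhds (A * 0)) :=
      (Real.tendsto_exp_neg_atTop_nhds_zero.comp
        ((tendsto_natCast_atTop_atTop (R := ℝ)).atTop_div_const (by norm_num))).const_mul A
    rw [mul_zero] at h1
    exact h1.eventually_le_const (by linarith)
  obtain ⟨L₁, hL₁⟩ := Filter.eventually_atTop.1 hev
  refine ⟨(fidelityConst D (lrConst D (interactionRange S) ‖g‖ t) (-Real.log q)).toNNReal,
    max L₁ (2 * interactionRange S + 1), fun L _ hL x => ?_⟩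
  have hL1 : L₁ ≤ L := (le_max_left _ _).trans hL
  have hL2 : 2 * interactionRange S + 1 ≤ L := (le_max_right _ _).trans hL
  have hh := isLocalHamiltonian_interactionTerm hL2 hg
  refine hh.ofReal_fidelity_sq_le hψ ht (κ := -Real.log q)
    (neg_pos.2 (Real.log_neg hq0 hq1)) x ?_
  have hp := (abs_le.1 (hA L hL2 x)).2
  have hle : siteOverlap (hamiltonian (interactionTerm g L)) (productState ψ D L) x t ≤ q := by
    linarith [hL₁ L hL1]
  rcases (siteOverlap_nonneg hψ (hamiltonian (interactionTerm g L)) x t).eq_or_lt with h0 | h0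
  · rw [rate_eq_top h0.symm.le]
    exact le_top
  · rw [rate_eq_ofReal h0]
    exact ENNReal.ofReal_le_ofReal (neg_le_neg (Real.log_le_log h0 hle))

/-- The fidelity bound for a fixed interaction, uniformly in the rate. -/
theorem exists_decay_bound_interaction {ψ : Fin d → ℂ} (hψ : ∑ i, ‖ψ i‖ ^ 2 = 1)
    {g : Matrix (S → Fin d) (S → Fin d) ℂ} (hg : g.IsHermitian) {t : ℝ} (ht : 0 ≤ t) :
    ∃ (C : ℝ≥0) (L₀ : ℕ), ∀ (L : ℕ) [NeZero L], L₀ ≤ L → ∀ x : Site D L,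
      ENNReal.ofReal (fidelity (hamiltonian (interactionTerm g L)) (productState ψ D L) t ^ 2) ≤
        (C : ℝ≥0∞) * decay D L (rate (hamiltonian (interactionTerm g L))
          (productState ψ D L) x t) := by
  obtain ⟨A, p, hA⟩ := exists_limit_siteOverlap (D := D) ψ hψ g hg ht
  by_cases hp : p < 1
  · exact exists_decay_bound_of_limit_lt_one hψ hg ht hp hA
  -- The overlaps are at most 1 ≤ p, hence at least as close to 1 as to p; p = 1 need not be proved.
  · refine exists_decay_bound_of_rate_small hψ hg (A := A) (t := t) fun L _ hL x => ?_
    have h1 := hA L hL x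
    have h2 := siteOverlap_le_one hψ (isLocalHamiltonian_interactionTerm hL hg).isHermitian x t
    rw [abs_sub_comm, abs_of_nonneg (by linarith)] at h1 ⊢
    linarith

end Interaction

end SpinLattice

end


theorem theorem5 (D d : ℕ) (hD : 1 ≤ D) :
    -- arbitrarily small times with positive rate, common to all system sizes
    (∀ (ψ : Fin d → ℂ), ∑ i, ‖ψ i‖ ^ 2 = 1 →
      ∀ (r : ℕ) (J : ℝ) (h : ∀ (L : ℕ) [NeZero L], SpinLattice.Site D L → SpinLattice.Op D d L),
      (∀ (L : ℕ) [NeZero L], SpinLattice.IsLocalHamiltonian r J (h L)) →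
      ∀ δ : ℝ, 0 < δ → ∃ τ : ℝ, 0 < τ ∧ τ < δ ∧ ∀ (L : ℕ) [NeZero L],
        ¬ SpinLattice.IsEigenstate (SpinLattice.hamiltonian (h L))
            (SpinLattice.productState ψ D L) →
        ∀ x : SpinLattice.Site D L,
          0 < SpinLattice.rate (SpinLattice.hamiltonian (h L))
            (SpinLattice.productState ψ D L) x τ) ∧
    -- the bound for all Hamiltonians of given range and strength, uniformly over `k(τ) ≥ κ > 0`
    (∀ (r : ℕ) (J τ κ : ℝ), 0 < τ → 0 < κ →
      ∃ (C : ℝ≥0) (L₀ : ℕ), ∀ (L : ℕ) [NeZero L], L₀ ≤ L →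
        ∀ (ψ : Fin d → ℂ), ∑ i, ‖ψ i‖ ^ 2 = 1 →
        ∀ (h : SpinLattice.Site D L → SpinLattice.Op D d L),
        SpinLattice.IsLocalHamiltonian r J h →
        ∀ x : SpinLattice.Site D L,
          ENNReal.ofReal κ ≤ SpinLattice.rate (SpinLattice.hamiltonian h)
            (SpinLattice.productState ψ D L) x τ →
          ENNReal.ofReal (SpinLattice.fidelity (SpinLattice.hamiltonian h)
              (SpinLattice.productState ψ D L) τ ^ 2) ≤
            (C : ℝ≥0∞) * SpinLattice.decay D L (SpinLattice.rate (SpinLattice.hamiltonian h)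
              (SpinLattice.productState ψ D L) x τ)) ∧
    -- the bound for a fixed interaction, with no lower bound on `k(τ) > 0` that is uniform in `L`
    (∀ (ψ : Fin d → ℂ), ∑ i, ‖ψ i‖ ^ 2 = 1 →
      ∀ (S : Finset (Fin D → ℤ)) (g : Matrix (S → Fin d) (S → Fin d) ℂ), g.IsHermitian →
      ∀ τ : ℝ, 0 < τ →
      ∃ (C : ℝ≥0) (L₀ : ℕ), ∀ (L : ℕ) [NeZero L], L₀ ≤ L →
        ∀ x : SpinLattice.Site D L,
          0 < SpinLattice.rate (SpinLattice.hamiltonian (SpinLattice.interactionTerm g L))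
            (SpinLattice.productState ψ D L) x τ →
          ENNReal.ofReal (SpinLattice.fidelity
              (SpinLattice.hamiltonian (SpinLattice.interactionTerm g L))
              (SpinLattice.productState ψ D L) τ ^ 2) ≤
            (C : ℝ≥0∞) * SpinLattice.decay D L
              (SpinLattice.rate (SpinLattice.hamiltonian (SpinLattice.interactionTerm g L))
                (SpinLattice.productState ψ D L) x τ)) := by
  refine ⟨fun ψ hψ r J h hh δ hδ => SpinLattice.exists_small_time_rate_pos hψ h hh hδ,
    -- The uniform bound holds from L₀ = 0 on; its constant depends only on D, r, J, τ and κ.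
    fun r J τ κ hτ hκ => ⟨_, 0, fun L _ _ ψ hψ h hh x hk =>
      hh.ofReal_fidelity_sq_le hψ hτ.le hκ x hk⟩, fun ψ hψ S g hg τ hτ => ?_⟩
  obtain ⟨C, L₀, hC⟩ := SpinLattice.exists_decay_bound_interaction (D := D) hψ hg hτ.le
  exact ⟨C, L₀, fun L _ hL x _ => hC L hL x⟩
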